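/- Let $m_1,m_2,n,k,D\ge 1$ and $d\ge 0$ be integers, and let $[n]=\{1,\dots,n\}$. A *deterministic protocol* on $X\times Y$ is a binary tree in which each inner node is owned by Alice (holding $x\in X$) or Bob (holding $y\in Y$), who sends one bit depending on the owner's input, and each leaf carries an output in $\{\pm1\}$; its cost is the depth of the tree. A *randomized protocol* with at most $d$ bits of communication is a probability distribution over deterministic protocols of cost at most $d$; it is identified with the function $\mathcal C\colon X\times Y\to[-1,1]$ giving its expected output. Likewise, a *randomized decision tree* of depth at most $D$ is a probability distribution over deterministic decision trees of depth at most $D$ that query coordinates of $z\in\{\pm1\}^n$ and have outputs in $\{\pm1\}$; it is identified with its expected output $\mathcal T\colon\{\pm1\}^n\to[-1,1]$. For a gadget $g\colon\{\pm1\}^{m_1}\times\{\pm1\}^{m_2}\to\{\pm1\}$ put $\hat g(S,T)=\mathbb E_{x,y}\big[g(x,y)\prod_{i\in S}x_i\prod_{j\in T}y_j\big]$ for $S\subseteq[m_1]$, $T\subseteq[m_2]$ and uniform $x,y$, and call $g$ *balanced* if $\hat g(S,T)=0$ whenever $S=\emptyset$ or $T=\emptyset$. For balanced $g$, the *$g$-fiber*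 of $\mathcal C\colon(\{\pm1\}^{m_1})^n\times(\{\pm1\}^{m_2})^n\to[-1,1]$ is $$\mathcal C_{\downarrow g}(z)=\mathbb E_{x,y}\big[\mathcal C(x,y)\mid g(x_i,y_i)=z_i\ \forall i\in[n]\big],\qquad z\in\{\pm1\}^n,$$ for uniform $x,y$; the *XOR-fiber* $\mathcal C'_{\downarrow\mathrm{XOR}}$ of $\mathcal C'\colon\{\pm1\}^n\times\{\pm1\}^n\to[-1,1]$ is the same with $g(a,b)=ab$ on $\{\pm1\}\times\{\pm1\}$. For $f\colon\{\pm1\}^n\to\mathbb R$ let $L_{1,k}(f)=\sum_{S\subseteq[n],\,|S|=k}\big|\mathbb E_z[f(z)\prod_{i\in S}z_i]\big|$. **Theorem.** There is a universal constant $c>0$, not depending on any parameter, such that the following holds for all $m_1,m_2,n,k,D\ge1$ and $d\ge0$. Let $g\colon\{\pm1\}^{m_1}\times\{\pm1\}^{m_2}\to\{\pm1\}$ be balanced, and assume that for every randomized protocol $\mathcal C\colon(\{\pm1\}^{m_1})^n\times(\{\pm1\}^{m_2})^n\to[-1,1]$ with at most $d$ bits of communication there is a randomized decision tree $\mathcal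 T$ of depth at most $D$ with $|\mathcal T(z)-\mathcal C_{\downarrow g}(z)|\le n^{-k}$ for all $z\in\{\pm1\}^n$. Then every randomized protocol $\mathcal C'\colon\{\pm1\}^n\times\{\pm1\}^n\to[-1,1]$ with at most $d$ bits of communication satisfies $$L_{1,k}(\mathcal C'_{\downarrow\mathrm{XOR}})\le\Big(\max_{S,T}|\hat g(S,T)|\Big)^{-k}\sqrt{D^k\,(c\log_2 n)^{k-1}}\le 2^{(m_1+m_2)k/2}\sqrt{D^k\,(c\log_2 n)^{k-1}}$$ (where $(c\log_2 n)^{0}=1$). -/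

import Mathlib

open Finset
open scoped BigOperators

noncomputable section

/-- The real number `1` or `-1` represented by an element of `{±1}`; the set `{±1}` itself is
modelled by the unit group `ℤˣ` of the integers. -/
def pm (u : ℤˣ) : ℝ := ((u : ℤ) : ℝ)

/-- The monomial `x_S = ∏_{i ∈ S} x_i` on the cube `{±1}^m`. -/
def chi {m : ℕ} (S : Finset (Fin m)) (x : Fin m → ℤˣ) : ℝ := ∏ i ∈ S, pm (x i)

/-- The Fourier coefficient `E_z[f(z) z_S]`, for uniform `z ∈ {±1}^n`. -/
def fourierCoef {n : ℕ} (f : (Fin n → ℤˣ) → ℝ) (S : Finset (Fin n)) : ℝ :=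
  𝔼 z : Fin n → ℤˣ, f z * chi S z

/-- The level-`k` Fourier growth: the sum of `|f^(S)|` over all `S` of size `k`. -/
def fourierGrowth {n : ℕ} (k : ℕ) (f : (Fin n → ℤˣ) → ℝ) : ℝ :=
  ∑ S ∈ Finset.powersetCard k (Finset.univ : Finset (Fin n)), |fourierCoef f S|

/-- The Fourier coefficient `E_{x,y}[g(x,y) x_S y_T]` of a two-party gadget, for independent
uniform `x ∈ {±1}^{m₁}` and `y ∈ {±1}^{m₂}`. -/
def gadgetCoef {m₁ m₂ : ℕ} (g : (Fin m₁ → ℤˣ) → (Fin m₂ → ℤˣ) → ℤˣ)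
    (S : Finset (Fin m₁)) (T : Finset (Fin m₂)) : ℝ :=
  𝔼 x : Fin m₁ → ℤˣ, 𝔼 y : Fin m₂ → ℤˣ, pm (g x y) * (chi S x * chi T y)

/-- A gadget is balanced if its Fourier coefficient at `(S, T)` vanishes whenever
`S` or `T` is empty. -/
def GadgetBalanced {m₁ m₂ : ℕ} (g : (Fin m₁ → ℤˣ) → (Fin m₂ → ℤˣ) → ℤˣ) : Prop :=
  ∀ (S : Finset (Fin m₁)) (T : Finset (Fin m₂)), S = ∅ ∨ T = ∅ → gadgetCoef g S T = 0

/-- The largest absolute value of a Fourier coefficient of a gadget. -/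
def gadgetMaxCoef {m₁ m₂ : ℕ} (g : (Fin m₁ → ℤˣ) → (Fin m₂ → ℤˣ) → ℤˣ) : ℝ :=
  (Finset.univ : Finset (Finset (Fin m₁) × Finset (Fin m₂))).sup' Finset.univ_nonempty
    (fun P => |gadgetCoef g P.1 P.2|)

/-- A deterministic two-party protocol (a protocol tree), with inputs in `X` for Alice and in `Y`
for Bob: at an inner node, one party sends a bit that depends on that party's input
(and on the node, that is, on the bits sent so far), and every leaf carries an output in `{±1}`. -/
inductive Protocol (X Y : Type) : Type
  | leaf (out : ℤˣ) : Protocol X Y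
  | alice (bit : X → Bool) (next₀ next₁ : Protocol X Y) : Protocol X Y
  | bob (bit : Y → Bool) (next₀ next₁ : Protocol X Y) : Protocol X Y

namespace Protocol

/-- The output of a deterministic protocol on the inputs `x` and `y`. -/
def run {X Y : Type} : Protocol X Y → X → Y → ℤˣ
  | leaf out, _, _ => out
  | alice bit p q, x, y => if bit x then q.run x y else p.run x y
  | bob bit p q, x, y => if bit y then q.run x y else p.run x y

/-- The number of bits sent in the worst case: the depth of the protocol tree. -/
def cost {X Y : Type} : Protocol X Y → ℕ
  | leaf _ => 0
  | alice _ p q => max p.cost q.cost + 1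
  | bob _ p q => max p.cost q.cost + 1

end Protocol

/-- A randomized protocol: a probability distribution over deterministic protocols. -/
abbrev RandProtocol (X Y : Type) : Type := PMF (Protocol X Y)

/-- A randomized protocol communicates at most `d` bits if every deterministic protocol in its
support does. -/
def RandProtocol.CostLE {X Y : Type} (C : RandProtocol X Y) (d : ℕ) : Prop :=
  ∀ P ∈ C.support, P.cost ≤ d

/-- The `[-1,1]`-valued function of a randomized protocol: the expected output over its
internal randomness. -/
def RandProtocol.value {X Y : Type} (C : RandProtocol X Y) (x : X) (y : Y) : ℝ :=
  ∑' P : Protocol X Y, (C P).toReal * pm (P.run x y)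

/-- A deterministic decision tree that queries coordinates of an input in `{±1}^n`, with outputs
in `{±1}` at the leaves. -/
inductive DecTree (n : ℕ) : Type
  | leaf (out : ℤˣ) : DecTree n
  | query (i : Fin n) (nextPos nextNeg : DecTree n) : DecTree n

namespace DecTree

/-- The output of a decision tree on the input `z`. -/
def run {n : ℕ} : DecTree n → (Fin n → ℤˣ) → ℤˣ
  | leaf out, _ => out
  | query i p q, z => if z i = 1 then p.run z else q.run z

/-- The depth of a decision tree: the number of queries in the worst case. -/
def depth {n : ℕ} : DecTree n → ℕ
  | leaf _ => 0
  | query _ p q => max p.depth q.depth + 1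

end DecTree

/-- A randomized decision tree: a probability distribution over deterministic decision trees. -/
abbrev RandDecTree (n : ℕ) : Type := PMF (DecTree n)

/-- A randomized decision tree has depth at most `D` if every decision tree in its support does. -/
def RandDecTree.DepthLE {n : ℕ} (T : RandDecTree n) (D : ℕ) : Prop :=
  ∀ t ∈ T.support, t.depth ≤ D

/-- The expected output of a randomized decision tree on the input `z`. -/
def RandDecTree.value {n : ℕ} (T : RandDecTree n) (z : Fin n → ℤˣ) : ℝ :=
  ∑' t : DecTree n, (T t).toReal * pm (t.run z)

/-- The fiber of a two-party function `F` on `A^n × B^n` along a map `g : A × B → {±1}`: its value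
at `z` is the expectation of `F(x,y)` for uniform `(x,y)` conditioned on `g(x_i,y_i) = z_i`
for all `i`. -/
def fiber {A B : Type} [Fintype A] [Fintype B] {n : ℕ} (g : A → B → ℤˣ)
    (F : (Fin n → A) → (Fin n → B) → ℝ) (z : Fin n → ℤˣ) : ℝ :=
  𝔼 p ∈ (Finset.univ : Finset ((Fin n → A) × (Fin n → B))) with ∀ i, g (p.1 i) (p.2 i) = z i,
    F p.1 p.2

/-- The XOR-fiber of a two-party function on `{±1}^n × {±1}^n`: the fiber along `(a,b) ↦ a * b`,
that is, conditioned on the entrywise product of `x` and `y` being `z`. -/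
def xorFiber {n : ℕ} (F : (Fin n → ℤˣ) → (Fin n → ℤˣ) → ℝ) (z : Fin n → ℤˣ) : ℝ :=
  fiber (fun a b : ℤˣ => a * b) F z

end

/-! Let `ρ` be the largest `|ĝ(S,T)|`, attained at some `S`, `T`, both nonempty since `g` is
balanced. If the players replace each input block by its parity over `S` resp. `T`, an XOR protocol
becomes a protocol for the gadget at the same cost. Balancedness gives `E[g | χ_S = a, χ_T = b] =
ĝ(S,T)·ab`, so the level-`k` growth of the `g`-fiber is exactly `ρ^k` times that of the XOR-fiber
(`fourierCoef_fiber_parity`). By hypothesis this fiber is within `n^{-k}` of a depth-`D` tree, and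
it remains to bound the growth of trees and the approximation error. Parseval gives `ρ^{-1} ≤
2^{(m₁+m₂)/2}`.

For a tree `f` and signs `w_S`, coefficients at sets that are not fully queried average out, so `∑
w_S f̂(S) ≤ E|P|`, where `P` is the sum of `w_S z_S` over `k`-subsets `S` of the queried set. Along
the exploration `P` is a martingale whose increment is a fresh sign times a polynomial of degree
`k-1` of the same kind. Orthogonality of increments handles the top degree
(`expect_derivSum_sq_le`). The next variable is adaptive, so the lower degrees need a union bound
over `n` candidates, hence `2m`-th moments with `m ≈ log₂ n`; each lower degree costs a factor
`O(m)` by a two-point inequality and Minkowski (`expect_derivSum_pow_le`). For `k ≥ 2` the total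
error is at most `1` and disappears in the constant.

For `k = 1` no constant is available: the bound is `√D` itself. With `d ≤ 1` the level vanishes, and
with `D ≥ n` a bounded function already satisfies it. Otherwise a two-bit protocol computing a
character of degree `D+1`, which no depth-`D` tree correlates with, forces `ρ^{D+1} ≤ 1/n`. This,
together with sharp estimates of the expected distance of a random walk, closes the gap in
`le_sqrt_depth`. -/

noncomputable section

/-! ### A two-point moment inequality -/

/-- The mean of the `2m`-th powers of `x + y` and `x - y`. -/
def twoPointMoment (m : ℕ) (x y : ℝ) : ℝ := ((x + y) ^ (2 * m) + (x - y) ^ (2 * m)) / 2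

lemma twoPointMoment_nonneg (m : ℕ) (x y : ℝ) : 0 ≤ twoPointMoment m x y := by
  unfold twoPointMoment
  have h₁ := (even_two_mul m).pow_nonneg (x + y)
  have h₂ := (even_two_mul m).pow_nonneg (x - y)
  linarith

/-- The even and odd parts of `(x + y)^(2m)` obey a coupled linear recursion in `m`. Carrying the
lower bound `0 ≤` through the induction is what allows the leftover skew terms to be discarded in
the upper bound. -/
lemma mul_twoPoint_skew_bounds (m : ℕ) (x y : ℝ) :
    0 ≤ x * y * (((x + y) ^ (2 * m) - (x - y) ^ (2 * m)) / 2) ∧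
      x * y * (((x + y) ^ (2 * m) - (x - y) ^ (2 * m)) / 2)
        ≤ 2 * m * y ^ 2 * twoPointMoment m x y := by
  induction m with
  | zero => simp
  | succ m ih =>
    obtain ⟨h₁, h₂⟩ := ih
    have hs := twoPointMoment_nonneg m x y
    set u := ((x + y) ^ (2 * m) - (x - y) ^ (2 * m)) / 2 with hu
    have eu : ((x + y) ^ (2 * (m + 1)) - (x - y) ^ (2 * (m + 1))) / 2
        = (x ^ 2 + y ^ 2) * u + 2 * x * y * twoPointMoment m x y := by
      rw [hu, twoPointMoment]; ring
    have es : twoPointMoment (m + 1) x y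
        = (x ^ 2 + y ^ 2) * twoPointMoment m x y + 2 * (x * y * u) := by
      rw [hu, twoPointMoment, twoPointMoment]; ring
    rw [eu, es]
    set s := twoPointMoment m x y
    have e : x * y * ((x ^ 2 + y ^ 2) * u + 2 * x * y * s)
        = (x ^ 2 + y ^ 2) * (x * y * u) + 2 * x ^ 2 * y ^ 2 * s := by ring
    rw [e]
    constructor
    · positivity
    · have h3 := mul_le_mul_of_nonneg_left h₂ (by positivity : 0 ≤ x ^ 2 + y ^ 2)
      have h4 : 0 ≤ y ^ 4 * s := by positivity
      have h5 : 0 ≤ (m : ℝ) * y ^ 2 * (x * y * u) := by positivity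
      have h6 : 0 ≤ y ^ 2 * (x * y * u) := by positivity
      push_cast
      nlinarith

/-- Each step of the recursion multiplies the moment by at most `x² + y² + 4my²`. The separate bound
`M` keeps the base of the power fixed during the induction; it is used with `M = m`. -/
lemma twoPointMoment_le {m M : ℕ} (h : m ≤ M) (x y : ℝ) :
    twoPointMoment m x y ≤ (x ^ 2 + 4 * M * y ^ 2) ^ m := by
  induction m with
  | zero => simp [twoPointMoment]
  | succ m ih =>
    have hs := twoPointMoment_nonneg m x y
    have h₂ := (mul_twoPoint_skew_bounds m x y).2
    have es : twoPointMoment (m + 1) x y = (x ^ 2 + y ^ 2) * twoPointMoment m x y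
        + 2 * (x * y * (((x + y) ^ (2 * m) - (x - y) ^ (2 * m)) / 2)) := by
      rw [twoPointMoment, twoPointMoment]; ring
    have hM : (m : ℝ) + 1 ≤ M := by exact_mod_cast h
    calc twoPointMoment (m + 1) x y
        ≤ (x ^ 2 + 4 * M * y ^ 2) * twoPointMoment m x y := by
          rw [es]
          have : 0 ≤ y ^ 2 * twoPointMoment m x y := by positivity
          nlinarith
      _ ≤ (x ^ 2 + 4 * M * y ^ 2) * (x ^ 2 + 4 * M * y ^ 2) ^ m := by
          gcongr; exact ih (by omega)
      _ = _ := by ring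

/-! ### Uniform averages: Minkowski, power means, involutions -/

section Expect
variable {ι : Type*} [Fintype ι]

lemma expect_nonneg_eq_zero [Nonempty ι] {f : ι → ℝ} (hf : ∀ i, 0 ≤ f i) (h : 𝔼 i, f i ≤ 0) (i : ι) :
    f i = 0 := by
  rw [Fintype.expect_eq_sum_div_card] at h
  have hc : (0 : ℝ) < Fintype.card ι := by exact_mod_cast Fintype.card_pos
  have h' : ∑ i, f i ≤ 0 := by
    by_contra hh
    push Not at hh
    exact absurd h (not_le.2 (div_pos hh hc))
  have := (Finset.sum_eq_zero_iff_of_nonneg (s := univ) fun i _ => hf i).1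
    (le_antisymm h' (Finset.sum_nonneg fun i _ => hf i))
  exact this i (mem_univ i)

/-- Minkowski's inequality in `L^m` for two nonnegative functions, without roots. -/
lemma expect_add_pow_le [Nonempty ι] {m : ℕ} (hm : m ≠ 0) {f g : ι → ℝ} {a b : ℝ}
    (hf : ∀ i, 0 ≤ f i) (hg : ∀ i, 0 ≤ g i) (ha : 0 ≤ a) (hb : 0 ≤ b)
    (hfa : 𝔼 i, f i ^ m ≤ a ^ m) (hgb : 𝔼 i, g i ^ m ≤ b ^ m) :
    𝔼 i, (f i + g i) ^ m ≤ (a + b) ^ m := by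
  -- The convexity argument divides by `a` and `b`; a zero bound forces the function itself to
  -- vanish.
  rcases ha.eq_or_lt with rfl | ha
  · have h0 : ∀ i, f i = 0 := fun i => by
      have := expect_nonneg_eq_zero (f := fun i => f i ^ m) (fun i => pow_nonneg (hf i) m)
        (by simpa [hm] using hfa) i
      exact pow_eq_zero_iff hm |>.1 this
    simpa [h0] using hgb
  rcases hb.eq_or_lt with rfl | hb
  · have h0 : ∀ i, g i = 0 := fun i => by
      have := expect_nonneg_eq_zero (f := fun i => g i ^ m) (fun i => pow_nonneg (hg i) m)
        (by simpa [hm] using hgb) i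
      exact pow_eq_zero_iff hm |>.1 this
    simpa [h0] using hfa
  have hab : 0 < a + b := by positivity
  -- Convexity of `t ^ m` at the points `f i / a` and `g i / b` with weights `a / (a + b)` and `b /
  -- (a + b)`.
  have key : ∀ i, (f i + g i) ^ m
      ≤ (a + b) ^ m * (a / (a + b) / a ^ m * f i ^ m + b / (a + b) / b ^ m * g i ^ m) := by
    intro i
    have h := (convexOn_pow m).2 (Set.mem_Ici.2 (div_nonneg (hf i) ha.le))
      (Set.mem_Ici.2 (div_nonneg (hg i) hb.le))
      (by positivity : 0 ≤ a / (a + b)) (by positivity : 0 ≤ b / (a + b)) (by field_simp)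
    simp only [smul_eq_mul, div_pow] at h
    have e : f i + g i = (a + b) * (a / (a + b) * (f i / a) + b / (a + b) * (g i / b)) := by
      field_simp
    rw [e, mul_pow]
    refine mul_le_mul_of_nonneg_left (h.trans_eq ?_) (by positivity)
    ring
  calc 𝔼 i, (f i + g i) ^ m
      ≤ 𝔼 i, (a + b) ^ m * (a / (a + b) / a ^ m * f i ^ m + b / (a + b) / b ^ m * g i ^ m) :=
        Finset.expect_le_expect fun i _ => key i
    _ = (a + b) ^ m * (a / (a + b) / a ^ m * 𝔼 i, f i ^ m + b / (a + b) / b ^ m * 𝔼 i, g i ^ m) := by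
        rw [← Finset.mul_expect, Finset.expect_add_distrib, ← Finset.mul_expect,
          ← Finset.mul_expect]
    _ ≤ (a + b) ^ m * (a / (a + b) / a ^ m * a ^ m + b / (a + b) / b ^ m * b ^ m) := by
        gcongr
    _ = (a + b) ^ m := by field_simp

lemma expect_pow_le_expect_pow [Nonempty ι] (m : ℕ) {f : ι → ℝ} (hf : ∀ i, 0 ≤ f i) :
    (𝔼 i, f i) ^ m ≤ 𝔼 i, f i ^ m := by
  have hc : (0 : ℝ) < Fintype.card ι := by exact_mod_cast Fintype.card_pos
  have := Real.pow_arith_mean_le_arith_mean_pow univ (fun _ : ι => (1 : ℝ) / Fintype.card ι) f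
    (fun i _ => by positivity) (by simp) (fun i _ => hf i) m
  rw [← Finset.mul_sum, ← Finset.mul_sum] at this
  simpa [Fintype.expect_eq_sum_div_card, div_eq_inv_mul] using this

lemma expect_abs_le_sqrt [Nonempty ι] {f : ι → ℝ} : 𝔼 i, |f i| ≤ √(𝔼 i, f i ^ 2) := by
  refine Real.le_sqrt_of_sq_le ?_
  simpa using expect_pow_le_expect_pow 2 (f := fun i => |f i|) fun i => abs_nonneg _

lemma expect_comp_involutive {σ : ι → ι} (hσ : Function.Involutive σ) (f : ι → ℝ) :
    𝔼 i, f (σ i) = 𝔼 i, f i :=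
  Fintype.expect_equiv hσ.toPerm _ _ fun _ => rfl

lemma expect_eq_zero_of_involutive {σ : ι → ι} (hσ : Function.Involutive σ) {f : ι → ℝ}
    (h : ∀ i, f (σ i) = - f i) : 𝔼 i, f i = 0 := by
  have := expect_comp_involutive hσ f
  simp only [h, Finset.expect_neg_distrib] at this
  linarith

lemma expect_eq_expect_average {σ : ι → ι} (hσ : Function.Involutive σ) (f : ι → ℝ) :
    𝔼 i, f i = 𝔼 i, (f i + f (σ i)) / 2 := by
  rw [← Finset.expect_div, Finset.expect_add_distrib, expect_comp_involutive hσ]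
  ring

end Expect

/-! ### Signs, monomials and coordinate flips -/

lemma pm_sq (u : ℤˣ) : pm u * pm u = 1 := by
  rcases Int.units_eq_one_or u with rfl | rfl <;> simp [pm]

lemma abs_pm (u : ℤˣ) : |pm u| = 1 := by
  rcases Int.units_eq_one_or u with rfl | rfl <;> simp [pm]

lemma pm_neg (u : ℤˣ) : pm (-u) = - pm u := by simp [pm]

lemma pm_one : pm 1 = 1 := by simp [pm]

lemma pm_mul (u v : ℤˣ) : pm (u * v) = pm u * pm v := by simp [pm]

lemma abs_chi {m : ℕ} (S : Finset (Fin m)) (x : Fin m → ℤˣ) : |chi S x| = 1 := by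
  simp [chi, Finset.abs_prod, abs_pm]

/-- Change the sign of the coordinate `i` of `z`. -/
def flipAt {n : ℕ} (i : Fin n) (z : Fin n → ℤˣ) : Fin n → ℤˣ := Function.update z i (- z i)

lemma flipAt_self {n : ℕ} (i : Fin n) (z : Fin n → ℤˣ) : flipAt i z i = - z i := by simp [flipAt]

lemma flipAt_of_ne {n : ℕ} {i j : Fin n} (h : j ≠ i) (z : Fin n → ℤˣ) : flipAt i z j = z j := by
  simp [flipAt, h]

lemma flipAt_flipAt {n : ℕ} (i : Fin n) (z : Fin n → ℤˣ) : flipAt i (flipAt i z) = z := by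
  simp [flipAt]

lemma chi_flipAt_of_mem {n : ℕ} {i : Fin n} {S : Finset (Fin n)} (h : i ∈ S)
    (z : Fin n → ℤˣ) : chi S (flipAt i z) = - chi S z := by
  rw [chi, chi, ← Finset.mul_prod_erase _ _ h, ← Finset.mul_prod_erase _ _ h, flipAt_self, pm_neg,
    neg_mul]
  congr 2
  exact Finset.prod_congr rfl fun j hj => by rw [flipAt_of_ne (Finset.ne_of_mem_erase hj)]

/-! ### Expected distance of the simple random walk -/

/-- The expected distance from the origin of a simple random walk that starts at `x`, after
`s` steps. -/
def walkAbs : ℕ → ℝ → ℝ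
  | 0, x => |x|
  | s + 1, x => (walkAbs s (x + 1) + walkAbs s (x - 1)) / 2

lemma walkAbs_le_succ (s : ℕ) (x : ℝ) : walkAbs s x ≤ walkAbs (s + 1) x := by
  induction s generalizing x with
  | zero =>
    simp only [walkAbs]
    have := abs_add_le (x + 1) (x - 1)
    rw [show x + 1 + (x - 1) = 2 * x by ring, abs_mul, abs_two] at this
    linarith
  | succ s ih =>
    rw [walkAbs, walkAbs]
    linarith [ih (x + 1), ih (x - 1)]

lemma walkAbs_monotone (x : ℝ) : Monotone fun s => walkAbs s x :=
  monotone_nat_of_le_succ fun s => walkAbs_le_succ s x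

lemma walkAbs_neg (s : ℕ) (x : ℝ) : walkAbs s (-x) = walkAbs s x := by
  induction s generalizing x with
  | zero => simp [walkAbs]
  | succ s ih =>
    rw [walkAbs, walkAbs, show -x + 1 = -(x - 1) by ring, show -x - 1 = -(x + 1) by ring, ih, ih,
      add_comm]

/-- The tangent bound `|x| ≤ (x² + a²) / (2a)` is propagated by the walk, because `x² + s`, with `s`
the remaining time, is preserved by averaging over a step. -/
lemma walkAbs_le_quadratic {a : ℝ} (ha : 0 < a) (s : ℕ) (x : ℝ) :
    walkAbs s x ≤ (x ^ 2 + s + a ^ 2) / (2 * a) := by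
  induction s generalizing x with
  | zero =>
    rw [walkAbs, le_div_iff₀ (by positivity)]
    have := sq_abs x
    push_cast
    nlinarith [sq_nonneg (|x| - a)]
  | succ s ih =>
    rw [walkAbs]
    refine (div_le_div_of_nonneg_right (add_le_add (ih (x + 1)) (ih (x - 1)))
      (by norm_num)).trans_eq ?_
    push_cast
    field_simp
    ring

lemma walkAbs_zero_le_sqrt (s : ℕ) : walkAbs s 0 ≤ √s := by
  rcases Nat.eq_zero_or_pos s with rfl | hs
  · simp [walkAbs]
  have h : 0 < √(s : ℝ) := Real.sqrt_pos.2 (by exact_mod_cast hs)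
  refine (walkAbs_le_quadratic h s 0).trans_eq ?_
  rw [Real.sq_sqrt (by positivity)]
  field_simp
  rw [Real.sq_sqrt (by positivity)]
  ring

/-- A cosine of frequency `π / a` is an eigenfunction of the step average, so it may be subtracted
from the quadratic bound at no cost in the induction. At `s = 0` the loss `(|x| - a)² / (2a)` of the
quadratic bound pays for the cosine term, by `1 - y²/2 ≤ cos y` with `y = π(|x| - a)/a`. -/
lemma walkAbs_le_trig {a : ℝ} (ha : 0 < a) (s : ℕ) (x : ℝ) :
    walkAbs s x ≤ (x ^ 2 + s + a ^ 2) / (2 * a)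
      - a / Real.pi ^ 2 * (1 + Real.cos (Real.pi / a) ^ s * Real.cos (Real.pi / a * x)) := by
  have hπ := Real.pi_pos
  induction s generalizing x with
  | zero =>
    set θ := Real.pi / a with hθ
    have hθ0 : 0 < θ := by positivity
    have h1 : Real.cos (θ * x) = - Real.cos (θ * (|x| - a)) := by
      have : θ * (|x| - a) = θ * |x| - Real.pi := by rw [hθ]; field_simp
      rw [this, Real.cos_sub_pi, neg_neg]
      rcases abs_choice x with h | h <;> rw [h]
      rw [mul_neg, Real.cos_neg]
    have h2 := Real.one_sub_sq_div_two_le_cos (x := θ * (|x| - a))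
    have h3 : a / Real.pi ^ 2 * (1 + Real.cos (θ * x)) ≤ a / Real.pi ^ 2 * ((θ * (|x| - a)) ^ 2 / 2) := by
      gcongr
      rw [h1]; linarith
    have h4 : a / Real.pi ^ 2 * ((θ * (|x| - a)) ^ 2 / 2) = (|x| - a) ^ 2 / (2 * a) := by
      rw [hθ]; field_simp
    have h5 : |x| = (x ^ 2 + a ^ 2) / (2 * a) - (|x| - a) ^ 2 / (2 * a) := by
      rw [← sq_abs x]; field_simp; ring
    simp only [walkAbs, Nat.cast_zero, add_zero, pow_zero, one_mul]
    linarith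
  | succ s ih =>
    rw [walkAbs]
    refine (div_le_div_of_nonneg_right (add_le_add (ih (x + 1)) (ih (x - 1)))
      (by norm_num)).trans_eq ?_
    have e₁ : Real.cos (Real.pi / a * (x + 1)) + Real.cos (Real.pi / a * (x - 1))
        = 2 * (Real.cos (Real.pi / a) * Real.cos (Real.pi / a * x)) := by
      rw [mul_add (Real.pi / a), mul_sub (Real.pi / a), mul_one, Real.cos_add, Real.cos_sub]
      ring
    have e₂ : ((x + 1) ^ 2 + s + a ^ 2) / (2 * a) + ((x - 1) ^ 2 + s + a ^ 2) / (2 * a)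
        = 2 * ((x ^ 2 + (s + 1 : ℕ) + a ^ 2) / (2 * a)) := by
      push_cast
      field_simp
      ring
    rw [pow_succ]
    linear_combination e₂ / 2 - a / Real.pi ^ 2 * Real.cos (Real.pi / a) ^ s / 2 * e₁

/-- With `a = √s` the quadratic part equals `√s`, and the trigonometric correction is at least `√s /
π² ≥ √s / 10`. The hypothesis `4 ≤ s` places `π / √s` in the range where the cosine is nonnegative.
-/
lemma walkAbs_zero_le {s : ℕ} (hs : 4 ≤ s) : walkAbs s 0 ≤ 9 / 10 * √s := by
  have hs' : (4 : ℝ) ≤ s := by exact_mod_cast hs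
  have h2 : 2 ≤ √(s : ℝ) := Real.le_sqrt_of_sq_le (by linarith)
  have h : 0 < √(s : ℝ) := by linarith
  have hπ := Real.pi_pos
  refine (walkAbs_le_trig h s 0).trans ?_
  have hc : 0 ≤ Real.cos (Real.pi / √s) := by
    refine Real.cos_nonneg_of_mem_Icc ⟨?_, ?_⟩
    · have : 0 < Real.pi / √(s : ℝ) := by positivity
      linarith
    · gcongr
  have hc' := pow_nonneg hc s
  have hπ2 : Real.pi ^ 2 ≤ 10 := by
    have := Real.pi_lt_d2
    nlinarith
  have e : ((0 : ℝ) ^ 2 + s + √(s : ℝ) ^ 2) / (2 * √s) = √s := by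
    field_simp
    rw [Real.sq_sqrt (by positivity)]
    ring
  have h3 : √(s : ℝ) / 10 ≤ √s / Real.pi ^ 2 := by gcongr
  have h4 : √(s : ℝ) / Real.pi ^ 2 ≤ √s / Real.pi ^ 2 * (1 + Real.cos (Real.pi / √s) ^ s * Real.cos (Real.pi / √s * 0)) := by
    rw [mul_zero, Real.cos_zero, mul_one]
    exact le_mul_of_one_le_right (by positivity) (by linarith)
  rw [e]
  linarith

/-- The numerators of the values of `walkAbs` at natural numbers: `2 ^ s * walkAbs s x`. -/
def walkNum : ℕ → ℕ → ℕ
  | 0, x => x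
  | s + 1, 0 => 2 * walkNum s 1
  | s + 1, x + 1 => walkNum s (x + 2) + walkNum s x

lemma walkAbs_natCast (s x : ℕ) : walkAbs s x = walkNum s x / 2 ^ s := by
  induction s generalizing x with
  | zero => simp [walkAbs, walkNum]
  | succ s ih =>
    cases x with
    | zero =>
      have h := ih 1
      rw [walkAbs, walkNum, Nat.cast_zero, zero_add, zero_sub, walkAbs_neg]
      push_cast at h ⊢
      rw [h, pow_succ]
      field_simp
      ring
    | succ x =>
      have h := ih (x + 2)
      rw [walkAbs, walkNum, show ((x + 1 : ℕ) : ℝ) + 1 = ((x + 2 : ℕ) : ℝ) by push_cast; ring,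
        show ((x + 1 : ℕ) : ℝ) - 1 = (x : ℝ) by push_cast; ring, h, ih, pow_succ]
      push_cast
      field_simp

lemma walkAbs_zero_eq (s : ℕ) : walkAbs s 0 = walkNum s 0 / 2 ^ s := by
  simpa using walkAbs_natCast s 0

lemma walkNum_fifteen : walkNum 15 0 = 102960 := by decide +kernel

/-! ### Exploration of a decision tree -/

namespace DecTree

variable {n : ℕ}

/-- The coordinate queried at the root. -/
def rootVar : DecTree n → Option (Fin n)
  | leaf _ => none
  | query i _ _ => some i

/-- The child of the root that is reached on the input `z` (a leaf is its own child). -/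
def child : DecTree n → (Fin n → ℤˣ) → DecTree n
  | leaf b, _ => leaf b
  | query i p q, z => if z i = 1 then p else q

/-- The subtree that is reached on the input `z` after `t` queries. -/
def subtree (T : DecTree n) (z : Fin n → ℤˣ) : ℕ → DecTree n
  | 0 => T
  | t + 1 => (T.subtree z t).child z

/-- The set of the coordinates of `z` that are queried in the first `t` steps. -/
def queried (T : DecTree n) (z : Fin n → ℤˣ) : ℕ → Finset (Fin n)
  | 0 => ∅
  | t + 1 => T.queried z t ∪ (T.subtree z t).rootVar.toFinset

/-- The coordinate queried in step `t + 1`, if it was not queried before. -/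
def newVar (T : DecTree n) (z : Fin n → ℤˣ) (t : ℕ) : Option (Fin n) :=
  (T.subtree z t).rootVar.filter fun i => i ∉ T.queried z t

lemma newVar_notMem {T : DecTree n} {z : Fin n → ℤˣ} {t : ℕ} {i : Fin n}
    (h : T.newVar z t = some i) : i ∉ T.queried z t := by
  simpa using (Option.filter_eq_some_iff.1 h).2

lemma queried_succ_of_some {T : DecTree n} {z : Fin n → ℤˣ} {t : ℕ} {i : Fin n}
    (h : T.newVar z t = some i) : T.queried z (t + 1) = insert i (T.queried z t) := by
  have h' := (Option.filter_eq_some_iff.1 h).1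
  ext j
  simp [queried, h']

lemma queried_succ_of_none {T : DecTree n} {z : Fin n → ℤˣ} {t : ℕ}
    (h : T.newVar z t = none) : T.queried z (t + 1) = T.queried z t := by
  have h' := Option.filter_eq_none_iff.1 h
  rw [queried, Finset.union_eq_left]
  intro j hj
  simpa using h' j (by simpa using hj)

lemma child_congr {T : DecTree n} {z z' : Fin n → ℤˣ} (h : ∀ i ∈ T.rootVar, z i = z' i) :
    T.child z = T.child z' := by
  cases T with
  | leaf => rfl
  | query i p q => simp only [child, h i rfl]

/-- The state after `t` steps depends only on the coordinates read so far. All the sign-flip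
arguments on trees rest on this. -/
lemma subtree_queried_congr {T : DecTree n} {z z' : Fin n → ℤˣ} {t : ℕ}
    (h : ∀ i ∈ T.queried z t, z i = z' i) :
    T.subtree z t = T.subtree z' t ∧ T.queried z t = T.queried z' t := by
  induction t with
  | zero => exact ⟨rfl, rfl⟩
  | succ t ih =>
    obtain ⟨h₁, h₂⟩ := ih fun i hi => h i (Finset.mem_union_left _ hi)
    refine ⟨?_, by rw [queried, queried, h₁, h₂]⟩
    rw [subtree, subtree, ← h₁]
    exact child_congr fun i hi => h i (Finset.mem_union_right _ (by simpa using hi))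

lemma run_subtree (T : DecTree n) (z : Fin n → ℤˣ) (t : ℕ) : (T.subtree z t).run z = T.run z := by
  induction t with
  | zero => rfl
  | succ t ih =>
    rw [← ih, subtree]
    cases T.subtree z t with
    | leaf => rfl
    | query i p q => simp only [child, run]; split_ifs <;> rfl

lemma depth_child (T : DecTree n) (z : Fin n → ℤˣ) : (T.child z).depth ≤ T.depth - 1 := by
  cases T with
  | leaf => simp [child, depth]
  | query i p q => simp only [child, depth]; split_ifs <;> simp

lemma depth_subtree (T : DecTree n) (z : Fin n → ℤˣ) (t : ℕ) :
    (T.subtree z t).depth ≤ T.depth - t := by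
  induction t with
  | zero => exact le_rfl
  | succ t ih =>
    have := depth_child (T.subtree z t) z
    rw [subtree]
    omega

lemma run_congr {T : DecTree n} {z z' : Fin n → ℤˣ} {D : ℕ} (hT : T.depth ≤ D)
    (h : ∀ i ∈ T.queried z D, z i = z' i) : T.run z = T.run z' := by
  have h' := (subtree_queried_congr h).1
  rw [← run_subtree T z D, ← run_subtree T z' D, ← h']
  have : (T.subtree z D).depth = 0 := by have := depth_subtree T z D; omega
  cases hs : T.subtree z D with
  | leaf => rfl
  | query i p q => rw [hs] at this; simp [depth] at this

lemma card_queried_le (T : DecTree n) (z : Fin n → ℤˣ) (t : ℕ) : #(T.queried z t) ≤ t := by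
  induction t with
  | zero => simp [queried]
  | succ t ih =>
    refine (Finset.card_union_le _ _).trans (Nat.add_le_add ih ?_)
    cases (T.subtree z t).rootVar <;> simp

/-- Change the sign of the coordinate that is newly queried in step `t + 1`, if there is one. -/
def flipNew (T : DecTree n) (t : ℕ) (z : Fin n → ℤˣ) : Fin n → ℤˣ :=
  (T.newVar z t).elim z fun i => flipAt i z

lemma flipNew_of_some {T : DecTree n} {z : Fin n → ℤˣ} {t : ℕ} {i : Fin n}
    (h : T.newVar z t = some i) : T.flipNew t z = flipAt i z := by simp [flipNew, h]

lemma flipNew_of_none {T : DecTree n} {z : Fin n → ℤˣ} {t : ℕ}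
    (h : T.newVar z t = none) : T.flipNew t z = z := by simp [flipNew, h]

lemma agree_flipNew (T : DecTree n) (t : ℕ) (z : Fin n → ℤˣ) :
    ∀ i ∈ T.queried z t, z i = T.flipNew t z i := by
  intro i hi
  cases h : T.newVar z t with
  | none => rw [flipNew_of_none h]
  | some j =>
    rw [flipNew_of_some h, flipAt_of_ne]
    rintro rfl
    exact newVar_notMem h hi

lemma queried_flipNew (T : DecTree n) (t : ℕ) (z : Fin n → ℤˣ) :
    T.queried (T.flipNew t z) t = T.queried z t :=
  (subtree_queried_congr (agree_flipNew T t z)).2.symm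

lemma newVar_flipNew (T : DecTree n) (t : ℕ) (z : Fin n → ℤˣ) :
    T.newVar (T.flipNew t z) t = T.newVar z t := by
  rw [newVar, newVar, queried_flipNew, (subtree_queried_congr (agree_flipNew T t z)).1]

lemma flipNew_involutive (T : DecTree n) (t : ℕ) : Function.Involutive (T.flipNew t) := by
  intro z
  have h' := newVar_flipNew T t z
  cases h : T.newVar z t with
  | none => rw [flipNew_of_none h, flipNew_of_none h]
  | some j =>
    rw [h] at h'
    rw [flipNew_of_some h', flipNew_of_some h, flipAt_flipAt]

/-- The coefficients of a tree at the sets that it does not query entirely do not matter. -/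
lemma expect_run_chi_eq_zero {T : DecTree n} {D : ℕ} (hT : T.depth ≤ D) (S : Finset (Fin n)) :
    𝔼 z : Fin n → ℤˣ, (if S ⊆ T.queried z D then 0 else pm (T.run z) * chi S z) = 0 := by
  classical
  -- Flip the least unqueried element of `S`. The run does not see the flip, so the queried set, and
  -- with it the flipped coordinate, is unchanged; hence `σ` is an involution that negates `chi S`
  -- and keeps the output.
  let σ : (Fin n → ℤˣ) → (Fin n → ℤˣ) := fun z =>
    if h : (S \ T.queried z D).Nonempty then flipAt ((S \ T.queried z D).min' h) z else z
  have hag : ∀ z, ∀ i ∈ T.queried z D, z i = σ z i := by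
    intro z i hi
    simp only [σ]
    split_ifs with h
    · rw [flipAt_of_ne]
      intro h'
      have := (S \ T.queried z D).min'_mem h
      rw [← h'] at this
      exact (Finset.mem_sdiff.1 this).2 hi
    · rfl
  have hq : ∀ z, T.queried (σ z) D = T.queried z D := fun z => (subtree_queried_congr (hag z)).2.symm
  have hσ : Function.Involutive σ := by
    intro z
    by_cases h : (S \ T.queried z D).Nonempty
    · have e₁ : σ z = flipAt ((S \ T.queried z D).min' h) z := by simp only [σ, dif_pos h]
      have e₂ : σ (σ z) = flipAt ((S \ T.queried z D).min' h) (σ z) := by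
        have : ∀ w, T.queried w D = T.queried z D →
            σ w = flipAt ((S \ T.queried z D).min' h) w := by
          intro w hw
          simp only [σ, hw, dif_pos h]
        exact this _ (hq z)
      rw [e₂, e₁, flipAt_flipAt]
    · have e₁ : σ z = z := by simp only [σ, dif_neg h]
      rw [e₁, e₁]
  refine expect_eq_zero_of_involutive hσ fun z => ?_
  rw [hq, ← run_congr hT (hag z)]
  by_cases h : S ⊆ T.queried z D
  · simp [h]
  · have h' : (S \ T.queried z D).Nonempty := Finset.sdiff_nonempty.2 h
    have hm := (Finset.mem_sdiff.1 ((S \ T.queried z D).min'_mem h')).1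
    simp only [if_neg h, σ, dif_pos h', chi_flipAt_of_mem hm, mul_neg]

end DecTree

/-! ### Homogeneous polynomials along the exploration, and the Fourier growth of trees -/

variable {n : ℕ}

/-- The homogeneous polynomial of degree `r` in the variables from `Q \ U` in which a monomial
`z_S` has the coefficient `w (S ∪ U)`. -/
def derivSum (w : Finset (Fin n) → ℝ) (r : ℕ) (U Q : Finset (Fin n)) (z : Fin n → ℤˣ) : ℝ :=
  ∑ S ∈ powersetCard r (Q \ U), w (S ∪ U) * chi S z

lemma derivSum_insert (w : Finset (Fin n) → ℝ) (r : ℕ) {U Q : Finset (Fin n)} {v : Fin n}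
    (hv : v ∉ Q) (z : Fin n → ℤˣ) :
    derivSum w (r + 1) U (insert v Q) z = derivSum w (r + 1) U Q z
      + pm (z v) * (if v ∈ U then 0 else derivSum w r (insert v U) Q z) := by
  by_cases hU : v ∈ U
  · rw [derivSum, derivSum, Finset.insert_sdiff_of_mem _ hU, if_pos hU, mul_zero, add_zero]
  have hvQ : v ∉ Q \ U := fun h => hv (Finset.mem_sdiff.1 h).1
  rw [if_neg hU, derivSum, Finset.insert_sdiff_of_notMem _ hU,
    Finset.powersetCard_succ_insert hvQ, Finset.sum_union, Finset.sum_image, derivSum, derivSum,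
    Finset.mul_sum]
  · congr 1
    have e : Q \ insert v U = Q \ U := by
      ext i
      simp only [Finset.mem_sdiff, Finset.mem_insert, not_or]
      constructor
      · rintro ⟨h₁, -, h₂⟩; exact ⟨h₁, h₂⟩
      · rintro ⟨h₁, h₂⟩; exact ⟨h₁, fun h => hv (h ▸ h₁), h₂⟩
    rw [e]
    refine Finset.sum_congr rfl fun S hS => ?_
    have hvS : v ∉ S := fun h => hvQ ((Finset.mem_powersetCard.1 hS).1 h)
    rw [chi, Finset.prod_insert hvS, ← chi, Finset.insert_union, Finset.union_insert]
    ring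
  · intro A hA B hB hAB
    have hA' : v ∉ A := fun h => hvQ ((Finset.mem_powersetCard.1 hA).1 h)
    have hB' : v ∉ B := fun h => hvQ ((Finset.mem_powersetCard.1 hB).1 h)
    rw [← Finset.erase_insert hA', ← Finset.erase_insert hB', hAB]
  · rw [Finset.disjoint_left]
    intro A hA hA'
    obtain ⟨B, -, rfl⟩ := Finset.mem_image.1 hA'
    exact hvQ ((Finset.mem_powersetCard.1 hA).1 (Finset.mem_insert_self _ _))

lemma derivSum_empty (w : Finset (Fin n) → ℝ) (r : ℕ) (U : Finset (Fin n)) (z : Fin n → ℤˣ) :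
    derivSum w (r + 1) U ∅ z = 0 := by
  rw [derivSum, Finset.empty_sdiff, Finset.powersetCard_eq_empty.2 (by simp), Finset.sum_empty]

lemma derivSum_congr (w : Finset (Fin n) → ℝ) (r : ℕ) (U : Finset (Fin n)) {Q : Finset (Fin n)}
    {z z' : Fin n → ℤˣ} (h : ∀ i ∈ Q, z i = z' i) : derivSum w r U Q z = derivSum w r U Q z' := by
  refine Finset.sum_congr rfl fun S hS => ?_
  congr 1
  refine Finset.prod_congr rfl fun i hi => ?_
  rw [h i (Finset.mem_sdiff.1 ((Finset.mem_powersetCard.1 hS).1 hi)).1]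

namespace DecTree

/-- The factor of the new variable in the increment of `derivSum w (r + 1) U` in step `t + 1`. -/
def incr (T : DecTree n) (w : Finset (Fin n) → ℝ) (r : ℕ) (U : Finset (Fin n)) (t : ℕ)
    (z : Fin n → ℤˣ) : ℝ :=
  (T.newVar z t).elim 0 fun v => if v ∈ U then 0 else derivSum w r (insert v U) (T.queried z t) z

/-- Averages along the exploration of a decision tree: the newly read variable is a fresh
uniform sign. -/
lemma expect_derivSum_succ (T : DecTree n) (w : Finset (Fin n) → ℝ) (r : ℕ) (U : Finset (Fin n))
    (t : ℕ) (φ : ℝ → ℝ) :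
    𝔼 z, φ (derivSum w (r + 1) U (T.queried z (t + 1)) z)
      = 𝔼 z, (φ (derivSum w (r + 1) U (T.queried z t) z + T.incr w r U t z)
          + φ (derivSum w (r + 1) U (T.queried z t) z - T.incr w r U t z)) / 2 := by
  rw [expect_eq_expect_average (T.flipNew_involutive t)]
  refine Finset.expect_congr rfl fun z _ => ?_
  cases h : T.newVar z t with
  | none => simp [flipNew_of_none h, queried_succ_of_none h, incr, h]
  | some v =>
    have hv := newVar_notMem h
    have h' : T.newVar (T.flipNew t z) t = some v := by rw [newVar_flipNew, h]
    have hc : ∀ s V, derivSum w s V (T.queried z t) (T.flipNew t z)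
        = derivSum w s V (T.queried z t) z := fun s V =>
      (derivSum_congr w s V (agree_flipNew T t z)).symm
    have e₁ : derivSum w (r + 1) U (T.queried z (t + 1)) z
        = derivSum w (r + 1) U (T.queried z t) z + pm (z v) * T.incr w r U t z := by
      rw [queried_succ_of_some h, derivSum_insert w r hv]
      simp [incr, h]
    have e₂ : derivSum w (r + 1) U (T.queried (T.flipNew t z) (t + 1)) (T.flipNew t z)
        = derivSum w (r + 1) U (T.queried z t) z - pm (z v) * T.incr w r U t z := by
      rw [queried_succ_of_some h', queried_flipNew, derivSum_insert w r hv, hc, hc,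
        flipNew_of_some h, flipAt_self, pm_neg]
      simp only [incr, h, Option.elim]
      ring
    rw [e₁, e₂]
    -- The sign of the new variable only exchanges the two terms of the average.
    rcases Int.units_eq_one_or (z v) with hz | hz <;> rw [hz]
    · simp [pm_one]
    · rw [pm_neg, pm_one, neg_one_mul, sub_neg_eq_add, ← sub_eq_add_neg, add_comm]

lemma incr_pow_le (T : DecTree n) (w : Finset (Fin n) → ℝ) (r : ℕ) (U : Finset (Fin n)) (t : ℕ)
    {m : ℕ} (hm : m ≠ 0) (z : Fin n → ℤˣ) :
    T.incr w r U t z ^ (2 * m)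
      ≤ ∑ v, derivSum w r (insert v U) (T.queried z t) z ^ (2 * m) := by
  have hnn : ∀ v ∈ (univ : Finset (Fin n)),
      0 ≤ derivSum w r (insert v U) (T.queried z t) z ^ (2 * m) :=
    fun v _ => (even_two_mul m).pow_nonneg _
  have hm' : 2 * m ≠ 0 := by omega
  cases h : T.newVar z t with
  | none => simpa [incr, h, hm] using Finset.sum_nonneg hnn
  | some v =>
    simp only [incr, h, Option.elim]
    split_ifs
    · rw [zero_pow hm']
      exact Finset.sum_nonneg hnn
    · exact Finset.single_le_sum hnn (mem_univ v)

/-- The next variable depends on `z`, so its derivative is bounded by the sum over all `n`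
candidates. With `n ≤ 2 ^ m` this union bound costs only a factor `2` after taking an `m`-th root.
-/
lemma expect_incr_pow_le (T : DecTree n) (w : Finset (Fin n) → ℝ) (r t : ℕ) {m : ℕ} (hm : m ≠ 0)
    (hn : n ≤ 2 ^ m) {b : ℝ} (hb : 0 ≤ b)
    (h : ∀ U, 𝔼 z, derivSum w r U (T.queried z t) z ^ (2 * m) ≤ b ^ m) (U : Finset (Fin n)) :
    𝔼 z, T.incr w r U t z ^ (2 * m) ≤ (2 * b) ^ m :=
  calc 𝔼 z, T.incr w r U t z ^ (2 * m)
      ≤ 𝔼 z, ∑ v, derivSum w r (insert v U) (T.queried z t) z ^ (2 * m) :=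
        Finset.expect_le_expect fun z _ => T.incr_pow_le w r U t hm z
    _ = ∑ v, 𝔼 z, derivSum w r (insert v U) (T.queried z t) z ^ (2 * m) :=
        Finset.expect_sum_comm _ _ _
    _ ≤ ∑ _v : Fin n, b ^ m := Finset.sum_le_sum fun v _ => h (insert v U)
    _ = n * b ^ m := by simp
    _ ≤ 2 ^ m * b ^ m := by gcongr; exact_mod_cast hn
    _ = (2 * b) ^ m := (mul_pow _ _ _).symm

/-- Moment bounds for the homogeneous polynomials seen along the exploration of a tree. -/
lemma expect_derivSum_pow_le (T : DecTree n) {w : Finset (Fin n) → ℝ} (hw : ∀ S, |w S| ≤ 1)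
    {m : ℕ} (hm : m ≠ 0) (hn : n ≤ 2 ^ m) (r t : ℕ) (U : Finset (Fin n)) :
    𝔼 z, derivSum w r U (T.queried z t) z ^ (2 * m) ≤ ((8 * m : ℝ) ^ r * t.choose r) ^ m := by
  induction r generalizing t U with
  | zero =>
    have : ∀ z, derivSum w 0 U (T.queried z t) z ^ (2 * m) ≤ 1 := by
      intro z
      simp only [derivSum, Finset.powersetCard_zero, Finset.sum_singleton, chi, Finset.prod_empty,
        mul_one, Finset.empty_union]
      rw [← (even_two_mul m).pow_abs]
      exact pow_le_one₀ (abs_nonneg _) (hw U)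
    simpa using Finset.expect_le_expect fun z (_ : z ∈ univ) => this z
  | succ r ihr =>
    induction t with
    | zero => simp [queried, derivSum_empty, hm]
    | succ t iht =>
      rw [expect_derivSum_succ T w r U t fun x => x ^ (2 * m)]
      set B : ℝ := (8 * m : ℝ) ^ r * t.choose r
      have hB : 0 ≤ B := by positivity
      -- Two-point inequality, then Minkowski in `L^m` for the squares. The factor `8m` is `4m` from
      -- the former times `2` from the union bound, and the binomial coefficients add up by Pascal's
      -- rule.
      calc _ ≤ 𝔼 z, (derivSum w (r + 1) U (T.queried z t) z ^ 2
                  + 4 * m * T.incr w r U t z ^ 2) ^ m :=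
            Finset.expect_le_expect fun z _ => twoPointMoment_le le_rfl _ _
        _ ≤ ((8 * m : ℝ) ^ (r + 1) * t.choose (r + 1) + 4 * m * (2 * B)) ^ m := by
            refine expect_add_pow_le hm (fun z => sq_nonneg _) (fun z => by positivity)
              (by positivity) (by positivity) ?_ ?_
            · simpa only [← pow_mul] using iht
            · have := expect_incr_pow_le T w r t hm hn hB (fun V => ihr t V) U
              simp only [mul_pow (4 * m : ℝ), ← pow_mul, ← Finset.mul_expect]
              gcongr
        _ = _ := by
            rw [Nat.choose_succ_succ]
            push_cast
            simp only [B]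
            ring

/-- In the second moment the cross terms cancel exactly, so the top degree costs only the `2` of the
union bound instead of `8m`. This is why the logarithm appears to the power `k - 1` and not `k`. -/
lemma expect_derivSum_sq_le (T : DecTree n) {w : Finset (Fin n) → ℝ} (hw : ∀ S, |w S| ≤ 1)
    {m : ℕ} (hm : m ≠ 0) (hn : n ≤ 2 ^ m) (r t : ℕ) :
    𝔼 z, derivSum w (r + 1) ∅ (T.queried z t) z ^ 2
      ≤ 2 * (8 * m : ℝ) ^ r * t.choose (r + 1) := by
  induction t with
  | zero => simp [queried, derivSum_empty]
  | succ t ih =>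
    set B : ℝ := (8 * m : ℝ) ^ r * t.choose r with hBdef
    have hB : 0 ≤ B := by positivity
    have h₁ : 𝔼 z, T.incr w r ∅ t z ^ 2 ≤ 2 * B := by
      -- The union bound is only affordable at order `2m`, so the second moment is bounded through
      -- the `2m`-th one.
      refine le_of_pow_le_pow_left₀ hm (by positivity) ?_
      refine (expect_pow_le_expect_pow m fun z => sq_nonneg _).trans ?_
      simpa only [← pow_mul] using expect_incr_pow_le T w r t hm hn hB
        (fun V => T.expect_derivSum_pow_le hw hm hn r t V) ∅
    rw [expect_derivSum_succ T w r ∅ t fun x => x ^ 2]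
    calc _ = 𝔼 z, (derivSum w (r + 1) ∅ (T.queried z t) z ^ 2 + T.incr w r ∅ t z ^ 2) :=
          Finset.expect_congr rfl fun z _ => by ring
      _ ≤ 2 * (8 * m : ℝ) ^ r * t.choose (r + 1) + 2 * B := by
          rw [Finset.expect_add_distrib]
          exact add_le_add ih h₁
      _ = _ := by
          rw [Nat.choose_succ_succ, hBdef]
          push_cast
          ring

/-- The Fourier coefficients of a tree tested against signs. -/
lemma sum_mul_fourierCoef_le {T : DecTree n} {D : ℕ} (hT : T.depth ≤ D) (w : Finset (Fin n) → ℝ)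
    (k : ℕ) :
    ∑ S ∈ powersetCard k univ, w S * fourierCoef (fun z => pm (T.run z)) S
      ≤ 𝔼 z, |derivSum w k ∅ (T.queried z D) z| := by
  have h : ∀ S, fourierCoef (fun z => pm (T.run z)) S
      = 𝔼 z, (if S ⊆ T.queried z D then pm (T.run z) * chi S z else 0) := by
    intro S
    have h0 := expect_run_chi_eq_zero hT S
    have e : fourierCoef (fun z => pm (T.run z)) S
        = (𝔼 z, (if S ⊆ T.queried z D then pm (T.run z) * chi S z else 0))
          + 𝔼 z, (if S ⊆ T.queried z D then 0 else pm (T.run z) * chi S z) := by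
      rw [fourierCoef, ← Finset.expect_add_distrib]
      refine Finset.expect_congr rfl fun z _ => ?_
      split_ifs <;> simp
    rw [e, h0, add_zero]
  calc _ = 𝔼 z, pm (T.run z) * derivSum w k ∅ (T.queried z D) z := by
        simp only [h, Finset.mul_expect]
        rw [← Finset.expect_sum_comm]
        refine Finset.expect_congr rfl fun z _ => ?_
        rw [derivSum, Finset.mul_sum, Finset.sdiff_empty]
        simp only [Finset.union_empty]
        have e : powersetCard k (T.queried z D)
            = (powersetCard k univ).filter fun S => S ⊆ T.queried z D := by
          ext S
          simp [Finset.mem_powersetCard, and_comm]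
        rw [e, Finset.sum_filter]
        refine Finset.sum_congr rfl fun S _ => ?_
        split_ifs
        · ring
        · simp
    _ ≤ _ := Finset.expect_le_expect fun z _ => (le_abs_self _).trans (by
        rw [abs_mul, abs_pm, one_mul])

lemma fourierCoef_run_eq_zero {T : DecTree n} {D : ℕ} (hT : T.depth ≤ D) {S : Finset (Fin n)}
    (hS : D < #S) : fourierCoef (fun z => pm (T.run z)) S = 0 := by
  rw [fourierCoef, ← expect_run_chi_eq_zero hT S]
  refine Finset.expect_congr rfl fun z _ => ?_
  rw [if_neg fun h => ?_]
  have := (Finset.card_le_card h).trans (T.card_queried_le z D)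
  omega

lemma incr_zero_abs (T : DecTree n) {w : Finset (Fin n) → ℝ} (hw : ∀ S, |w S| = 1) (t : ℕ)
    (z : Fin n → ℤˣ) : T.incr w 0 ∅ t z = 0 ∨ |T.incr w 0 ∅ t z| = 1 := by
  cases h : T.newVar z t with
  | none => simp [incr, h]
  | some v => right; simp [incr, h, derivSum, chi, hw]

/-- At degree one every increment is `0` or a sign. Unrolling the tree from its last step trades
each step for one step of the walk; an idle step is covered by monotonicity in time. -/
lemma expect_walkAbs_derivSum_le (T : DecTree n) {w : Finset (Fin n) → ℝ} (hw : ∀ S, |w S| = 1)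
    (t s : ℕ) : 𝔼 z, walkAbs s (derivSum w 1 ∅ (T.queried z t) z) ≤ walkAbs (s + t) 0 := by
  induction t generalizing s with
  | zero => simp [queried, derivSum_empty]
  | succ t ih =>
    rw [expect_derivSum_succ T w 0 ∅ t (walkAbs s), show s + (t + 1) = (s + 1) + t by ring]
    refine le_trans (Finset.expect_le_expect fun z _ => ?_) (ih (s + 1))
    rcases T.incr_zero_abs hw t z with h | h
    · rw [h, add_zero, sub_zero, add_self_div_two]
      exact walkAbs_le_succ _ _
    · rw [walkAbs]
      rcases abs_choice (T.incr w 0 ∅ t z) with h' | h'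
      · rw [← h', h]
      · rw [h] at h'
        rw [show T.incr w 0 ∅ t z = -1 by linarith, sub_neg_eq_add, ← sub_eq_add_neg, add_comm]

end DecTree

/-- A sum of `n` independent uniform signs. -/
lemma expect_abs_sum_le_walkAbs (w : Fin n → ℝ) (hw : ∀ i, |w i| = 1) :
    𝔼 z : Fin n → ℤˣ, |∑ i, w i * pm (z i)| ≤ walkAbs n 0 := by
  have key : ∀ (R : Finset (Fin n)) (s : ℕ),
      𝔼 z : Fin n → ℤˣ, walkAbs s (∑ i ∈ R, w i * pm (z i)) ≤ walkAbs (s + #R) 0 := by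
    intro R
    induction R using Finset.induction_on with
    | empty => simp
    | insert i R hi ih =>
      intro s
      rw [Finset.card_insert_of_notMem hi, show s + (#R + 1) = (s + 1) + #R by ring]
      refine le_trans (le_of_eq ?_) (ih (s + 1))
      rw [expect_eq_expect_average (σ := flipAt i) (flipAt_flipAt i)]
      refine Finset.expect_congr rfl fun z _ => ?_
      have e : ∑ j ∈ R, w j * pm (flipAt i z j) = ∑ j ∈ R, w j * pm (z j) :=
        Finset.sum_congr rfl fun j hj => by rw [flipAt_of_ne (by rintro rfl; exact hi hj)]
      rw [Finset.sum_insert hi, Finset.sum_insert hi, e, flipAt_self, pm_neg, walkAbs]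
      have h : |w i * pm (z i)| = 1 := by rw [abs_mul, hw, abs_pm, one_mul]
      rcases abs_choice (w i * pm (z i)) with h' | h'
      · rw [mul_neg, ← h', h, add_comm 1, neg_add_eq_sub]
      · rw [h] at h'
        rw [mul_neg, show w i * pm (z i) = -1 by linarith, neg_neg, add_comm 1, neg_add_eq_sub,
          add_comm]
  simpa [walkAbs] using key univ 0

/-! ### Averages over probability distributions -/

section PMFMean
variable {α β : Type*} (p : PMF α)

lemma PMF.summable_toReal : Summable fun a => (p a).toReal :=
  ENNReal.summable_toReal p.tsum_coe_ne_top

lemma PMF.tsum_toReal : ∑' a, (p a).toReal = 1 := by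
  rw [← ENNReal.tsum_toReal_eq fun a => p.apply_ne_top a, p.tsum_coe, ENNReal.toReal_one]

lemma PMF.summable_toReal_mul {h : α → ℝ} {B : ℝ} (hB : ∀ a, |h a| ≤ B) :
    Summable fun a => (p a).toReal * h a := by
  refine Summable.of_norm_bounded (p.summable_toReal.mul_right B) fun a => ?_
  rw [Real.norm_eq_abs, abs_mul, abs_of_nonneg ENNReal.toReal_nonneg]
  exact mul_le_mul_of_nonneg_left (hB a) ENNReal.toReal_nonneg

lemma PMF.tsum_toReal_mul_le {h : α → ℝ} {B C : ℝ} (hB : ∀ a, |h a| ≤ B)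
    (hC : ∀ a ∈ p.support, h a ≤ C) : ∑' a, (p a).toReal * h a ≤ C := by
  calc ∑' a, (p a).toReal * h a ≤ ∑' a, (p a).toReal * C := by
        refine (p.summable_toReal_mul hB).tsum_le_tsum (fun a => ?_) (p.summable_toReal.mul_right C)
        by_cases ha : p a = 0
        · simp [ha]
        · exact mul_le_mul_of_nonneg_left (hC a ((p.mem_support_iff a).2 ha)) ENNReal.toReal_nonneg
    _ = C := by rw [tsum_mul_right, p.tsum_toReal, one_mul]

lemma PMF.abs_tsum_toReal_mul_le {h : α → ℝ} {B : ℝ} (hB : ∀ a, |h a| ≤ B) :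
    |∑' a, (p a).toReal * h a| ≤ B := by
  rw [abs_le]
  refine ⟨?_, p.tsum_toReal_mul_le hB fun a _ => (abs_le.1 (hB a)).2⟩
  have := p.tsum_toReal_mul_le (h := fun a => - h a) (B := B) (C := B)
    (fun a => by rw [abs_neg]; exact hB a) fun a _ => by linarith [(abs_le.1 (hB a)).1]
  simp only [mul_neg, tsum_neg] at this
  linarith

lemma PMF.sum_mul_tsum {ι : Type*} (s : Finset ι) (c : ι → ℝ) {h : α → ι → ℝ} {B : ℝ}
    (hB : ∀ a i, |h a i| ≤ B) :
    ∑ i ∈ s, c i * ∑' a, (p a).toReal * h a i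
      = ∑' a, (p a).toReal * ∑ i ∈ s, c i * h a i := by
  simp only [← tsum_mul_left, Finset.mul_sum]
  rw [← Summable.tsum_finsetSum fun i _ =>
    (p.summable_toReal_mul fun a => hB a i).mul_left (c i)]
  exact tsum_congr fun a => Finset.sum_congr rfl fun i _ => by ring

lemma PMF.tsum_map_toReal_mul (f : α → β) {h : β → ℝ} {B : ℝ} (hB : ∀ b, |h b| ≤ B) :
    ∑' b, ((p.map f) b).toReal * h b = ∑' a, (p a).toReal * h (f a) := by
  -- With the discrete σ-algebras every map is measurable, so the change of variables for integrals
  -- applies.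
  let _ : MeasurableSpace α := ⊤
  let _ : MeasurableSpace β := ⊤
  have hf : Measurable f := measurable_from_top
  have hh : Measurable h := measurable_from_top
  have h₁ := PMF.integral_eq_tsum (p.map f) h
    (MeasureTheory.Integrable.of_bound hh.aestronglyMeasurable B (Filter.Eventually.of_forall hB))
  have h₂ := PMF.integral_eq_tsum p (fun a => h (f a))
    (MeasureTheory.Integrable.of_bound (hh.comp hf).aestronglyMeasurable B
      (Filter.Eventually.of_forall fun a => hB (f a)))
  simp only [smul_eq_mul] at h₁ h₂
  rw [← h₁, ← h₂, ← PMF.toMeasure_map f p hf,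
    MeasureTheory.integral_map hf.aemeasurable hh.aestronglyMeasurable]

end PMFMean

/-! ### Fourier coefficients of fibers -/

section Fibers

lemma sum_comp_mul_prod {α β : Type*} [Fintype α] [Fintype β] [DecidableEq β] {n : ℕ}
    (π : α → β) (F : (Fin n → β) → ℝ) (h : Fin n → α → ℝ) :
    ∑ w : Fin n → α, F (fun i => π (w i)) * ∏ i, h i (w i)
      = ∑ c : Fin n → β, F c * ∏ i, ∑ u with π u = c i, h i u := by
  classical
  rw [← Finset.sum_fiberwise univ (fun w : Fin n → α => fun i => π (w i))]
  refine Finset.sum_congr rfl fun c _ => ?_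
  rw [Finset.prod_univ_sum, Finset.mul_sum]
  refine Finset.sum_congr ?_ fun w hw => ?_
  · ext w
    simp [Fintype.mem_piFinset, funext_iff]
  · rw [Fintype.mem_piFinset] at hw
    congr 2
    funext i
    exact (Finset.mem_filter.1 (hw i)).2

/-- The expectation is conditioned on the images `π (w i)`, over which the remaining product
factorizes by independence of the coordinates. -/
lemma expect_comp_mul_prod {α β : Type*} [Fintype α] [Fintype β] [DecidableEq β] {n : ℕ}
    [Nonempty α] [Nonempty β]
    (π : α → β) (F : (Fin n → β) → ℝ) (h : Fin n → α → ℝ) :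
    𝔼 w : Fin n → α, F (fun i => π (w i)) * ∏ i, h i (w i)
      = 𝔼 c : Fin n → β, F c *
          ∏ i, (Fintype.card β * 𝔼 u, if π u = c i then h i u else 0) := by
  have hα : (Fintype.card α : ℝ) ≠ 0 := by exact_mod_cast Fintype.card_ne_zero
  have hβ : (Fintype.card β : ℝ) ≠ 0 := by exact_mod_cast Fintype.card_ne_zero
  have e : ∀ c : Fin n → β,
      ∏ i, (Fintype.card β * 𝔼 u, if π u = c i then h i u else 0)
        = (Fintype.card β : ℝ) ^ n / (Fintype.card α : ℝ) ^ n
          * ∏ i, ∑ u with π u = c i, h i u := by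
    intro c
    simp only [Fintype.expect_eq_sum_div_card, ← Finset.sum_filter, Finset.prod_mul_distrib,
      Finset.prod_div_distrib, Finset.prod_const, Finset.card_univ, Fintype.card_fin]
    ring
  simp only [e]
  simp only [Fintype.expect_eq_sum_div_card, sum_comp_mul_prod, Fintype.card_fun,
    Fintype.card_fin, Nat.cast_pow, mul_left_comm (F _), ← Finset.mul_sum]
  field_simp

lemma pair_expect_eq {A B : Type} [Fintype A] [Fintype B] {n : ℕ}
    (F : (Fin n → A) × (Fin n → B) → ℝ) :
    𝔼 p, F p = 𝔼 w : Fin n → A × B, F (fun i => (w i).1, fun i => (w i).2) :=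
  (Fintype.expect_equiv (Equiv.arrowProdEquivProdArrow (Fin n) (fun _ => A) fun _ => B) _ _
    fun _ => rfl).symm

lemma chi_eq_prod_ite {n : ℕ} (J : Finset (Fin n)) (z : Fin n → ℤˣ) :
    chi J z = ∏ i, if i ∈ J then pm (z i) else 1 := by
  simp [chi, Finset.prod_ite_mem]

lemma ite_eq_pm (u v : ℤˣ) (r : ℝ) : (if u = v then r else 0) = (1 + pm u * pm v) / 2 * r := by
  rcases Int.units_eq_one_or u with rfl | rfl <;> rcases Int.units_eq_one_or v with rfl | rfl <;>
    simp [pm]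

lemma abs_fiber_le {A B : Type} [Fintype A] [Fintype B] {n : ℕ} (g : A → B → ℤˣ) {F : (Fin n → A) → (Fin n → B) → ℝ} {b : ℝ} (hb : 0 ≤ b)
    (hF : ∀ x y, |F x y| ≤ b) (z : Fin n → ℤˣ) : |fiber g F z| ≤ b := by
  rw [fiber]
  refine (Finset.abs_expect_le _ _).trans ?_
  rcases Finset.eq_empty_or_nonempty
    ({p : (Fin n → A) × (Fin n → B) | ∀ i, g (p.1 i) (p.2 i) = z i} : Finset _) with h | h
  · simpa [h] using hb
  · exact Finset.expect_le h fun p _ => hF _ _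

variable {A B : Type} [Fintype A] [Fintype B] [Nonempty A] [Nonempty B] {n : ℕ}

/-- The Fourier coefficients of a fiber along an unbiased gadget. -/
lemma fourierCoef_fiber (g : A → B → ℤˣ) (hg : 𝔼 p : A × B, pm (g p.1 p.2) = 0)
    (F : (Fin n → A) → (Fin n → B) → ℝ) (J : Finset (Fin n)) :
    fourierCoef (fiber g F) J
      = 𝔼 p : (Fin n → A) × (Fin n → B), F p.1 p.2 * chi J fun i => g (p.1 i) (p.2 i) := by
  classical
  have hprob : ∀ u : ℤˣ, (Fintype.card ℤˣ : ℝ) * (𝔼 p : A × B, if g p.1 p.2 = u then (1 : ℝ) else 0) = 1 := by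
    intro u
    have hc : Fintype.card ℤˣ = 2 := by decide
    simp only [ite_eq_pm, mul_one, ← Finset.expect_div, Finset.expect_add_distrib,
      ← Finset.expect_mul, hg, hc]
    simp
  -- An unbiased gadget has fibers of equal size, so averaging over a fiber and then over `z` is the
  -- plain average over all input pairs.
  have hcard : ∀ z : Fin n → ℤˣ,
      (2 : ℝ) ^ n * (#{p : (Fin n → A) × (Fin n → B) | ∀ i, g (p.1 i) (p.2 i) = z i} : ℝ)
        = Fintype.card ((Fin n → A) × (Fin n → B)) := by
    intro z
    have h := expect_comp_mul_prod (n := n) (fun p : A × B => g p.1 p.2)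
      (fun c => if c = z then (1 : ℝ) else 0) fun _ _ => 1
    simp only [hprob, Finset.prod_const_one, mul_one] at h
    rw [← pair_expect_eq (n := n) fun p : (Fin n → A) × (Fin n → B) =>
      if (fun i => g (p.1 i) (p.2 i)) = z then (1 : ℝ) else 0] at h
    simp only [Fintype.expect_eq_sum_div_card, Finset.sum_boole, Finset.filter_eq', mem_univ,
      if_true, Finset.card_singleton, Fintype.card_fun, Fintype.card_fin] at h
    simp only [funext_iff] at h
    have hc : Fintype.card ℤˣ = 2 := by decide
    rw [hc] at h
    have h0 : (Fintype.card ((Fin n → A) × (Fin n → B)) : ℝ) ≠ 0 := by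
      exact_mod_cast Fintype.card_ne_zero
    rw [div_eq_div_iff h0 (by positivity)] at h
    push_cast at h ⊢
    linarith
  have hN : (Fintype.card ((Fin n → A) × (Fin n → B)) : ℝ) ≠ 0 := by
    exact_mod_cast Fintype.card_ne_zero
  rw [fourierCoef, Fintype.expect_eq_sum_div_card, Fintype.expect_eq_sum_div_card,
    ← Finset.sum_fiberwise univ
      fun p : (Fin n → A) × (Fin n → B) => fun i => g (p.1 i) (p.2 i),
    Finset.sum_div, Finset.sum_div]
  refine Finset.sum_congr rfl fun z _ => ?_
  have hs : ∑ p : (Fin n → A) × (Fin n → B) with (fun i => g (p.1 i) (p.2 i)) = z,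
      F p.1 p.2 * chi J (fun i => g (p.1 i) (p.2 i))
      = (∑ p : (Fin n → A) × (Fin n → B) with ∀ i, g (p.1 i) (p.2 i) = z i, F p.1 p.2)
        * chi J z := by
    rw [Finset.sum_mul]
    refine Finset.sum_congr (by simp [funext_iff]) fun p hp => ?_
    rw [show (fun i => g (p.1 i) (p.2 i)) = z from funext (Finset.mem_filter.1 hp).2]
  have hc : Fintype.card ℤˣ = 2 := by decide
  rw [hs, fiber, Finset.expect_eq_sum_div_card, ← hcard z, Fintype.card_fun, Fintype.card_fin, hc]
  have := hcard z
  have h2 : (#{p : (Fin n → A) × (Fin n → B) | ∀ i, g (p.1 i) (p.2 i) = z i} : ℝ) ≠ 0 := by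
    intro h0
    rw [h0, mul_zero] at this
    exact hN this.symm
  push_cast
  field_simp

lemma expect_pm_mul : 𝔼 p : ℤˣ × ℤˣ, pm (p.1 * p.2) = 0 := by
  refine expect_eq_zero_of_involutive (σ := fun p => (-p.1, p.2)) (fun p => by simp) fun p => ?_
  rw [neg_mul, pm_neg]

lemma chi_mul (J : Finset (Fin n)) (x y : Fin n → ℤˣ) :
    chi J (fun i => x i * y i) = chi J x * chi J y := by
  simp [chi, pm_mul, Finset.prod_mul_distrib]

lemma fourierCoef_xorFiber (F : (Fin n → ℤˣ) → (Fin n → ℤˣ) → ℝ) (J : Finset (Fin n)) :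
    fourierCoef (xorFiber F) J
      = 𝔼 p : (Fin n → ℤˣ) × (Fin n → ℤˣ), F p.1 p.2 * (chi J p.1 * chi J p.2) := by
  unfold xorFiber
  rw [fourierCoef_fiber _ expect_pm_mul]
  simp only [chi_mul]

end Fibers

/-! ### Parity substitution and the largest gadget coefficient -/

section Gadgets
variable {m₁ m₂ n : ℕ}

/-- The monomial `x_S` as a sign. -/
def parity {m : ℕ} (S : Finset (Fin m)) (x : Fin m → ℤˣ) : ℤˣ := ∏ i ∈ S, x i

lemma pm_parity {m : ℕ} (S : Finset (Fin m)) (x : Fin m → ℤˣ) : pm (parity S x) = chi S x := by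
  simp [pm, parity, chi]

lemma expect_chi {m : ℕ} {S : Finset (Fin m)} (hS : S.Nonempty) :
    𝔼 x : Fin m → ℤˣ, chi S x = 0 := by
  obtain ⟨i, hi⟩ := hS
  exact expect_eq_zero_of_involutive (σ := flipAt i) (flipAt_flipAt i) fun x =>
    chi_flipAt_of_mem hi x

lemma expect_prod_eq {A B : Type*} [Fintype A] [Fintype B] (f : A × B → ℝ) :
    𝔼 p, f p = 𝔼 a, 𝔼 b, f (a, b) := by
  rw [← Finset.univ_product_univ, Finset.expect_product]

lemma gadgetCoef_eq (g : (Fin m₁ → ℤˣ) → (Fin m₂ → ℤˣ) → ℤˣ) (S : Finset (Fin m₁))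
    (T : Finset (Fin m₂)) :
    gadgetCoef g S T = 𝔼 p : (Fin m₁ → ℤˣ) × (Fin m₂ → ℤˣ),
      pm (g p.1 p.2) * (chi S p.1 * chi T p.2) := by
  rw [expect_prod_eq]; rfl

lemma GadgetBalanced.expect_eq_zero {g : (Fin m₁ → ℤˣ) → (Fin m₂ → ℤˣ) → ℤˣ}
    (hg : GadgetBalanced g) : 𝔼 p : (Fin m₁ → ℤˣ) × (Fin m₂ → ℤˣ), pm (g p.1 p.2) = 0 := by
  have := hg ∅ ∅ (Or.inl rfl)
  rw [gadgetCoef_eq] at this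
  simpa [chi] using this

/-- Substituting parities for the two inputs turns the fiber along a balanced gadget into
the XOR-fiber, up to a power of the Fourier coefficient of the gadget at these parities. -/
lemma fourierCoef_fiber_parity {g : (Fin m₁ → ℤˣ) → (Fin m₂ → ℤˣ) → ℤˣ} (hg : GadgetBalanced g)
    {S : Finset (Fin m₁)} {T : Finset (Fin m₂)} (hS : S.Nonempty) (hT : T.Nonempty)
    (F : (Fin n → ℤˣ) → (Fin n → ℤˣ) → ℝ) (J : Finset (Fin n)) :
    fourierCoef (fiber g fun x y => F (fun i => parity S (x i)) fun i => parity T (y i)) J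
      = gadgetCoef g S T ^ #J * fourierCoef (xorFiber F) J := by
  rw [fourierCoef_fiber g hg.expect_eq_zero, fourierCoef_xorFiber, pair_expect_eq, pair_expect_eq]
  simp only [chi_eq_prod_ite J]
  have h := expect_comp_mul_prod (n := n)
    (fun p : (Fin m₁ → ℤˣ) × (Fin m₂ → ℤˣ) => (parity S p.1, parity T p.2))
    (fun c => F (fun i => (c i).1) fun i => (c i).2)
    fun i p => if i ∈ J then pm (g p.1 p.2) else 1
  refine h.trans ?_
  rw [Finset.mul_expect]
  refine Finset.expect_congr rfl fun c _ => ?_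
  have hc : (Fintype.card (ℤˣ × ℤˣ) : ℝ) = 4 := by
    have : Fintype.card (ℤˣ × ℤˣ) = 4 := by decide
    rw [this]; norm_num
  -- Fourier expansion of the indicator of prescribed parities. Weighted by `g`, only the `χ_S χ_T`
  -- term survives, by balancedness; weighted by `1`, only the constant one, as `S` and `T` are
  -- nonempty.
  have hite : ∀ (p : (Fin m₁ → ℤˣ) × (Fin m₂ → ℤˣ)) (a b : ℤˣ) (r : ℝ),
      (if (parity S p.1, parity T p.2) = (a, b) then r else 0)
        = (r + pm a * (r * chi S p.1) + pm b * (r * chi T p.2)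
            + pm a * pm b * (r * (chi S p.1 * chi T p.2))) / 4 := by
    intro p a b r
    have : (if (parity S p.1, parity T p.2) = (a, b) then r else 0)
        = if parity S p.1 = a then (if parity T p.2 = b then r else 0) else 0 := by
      simp only [Prod.mk.injEq]
      split_ifs <;> simp_all
    rw [this, ite_eq_pm, ite_eq_pm, pm_parity, pm_parity]
    ring
  have key : ∀ i, (Fintype.card (ℤˣ × ℤˣ) : ℝ) * (𝔼 p : (Fin m₁ → ℤˣ) × (Fin m₂ → ℤˣ),
      if (parity S p.1, parity T p.2) = c i then (if i ∈ J then pm (g p.1 p.2) else 1) else 0)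
      = if i ∈ J then gadgetCoef g S T * (pm (c i).1 * pm (c i).2) else 1 := by
    intro i
    have h₁ := hg S ∅ (Or.inr rfl)
    have h₂ := hg ∅ T (Or.inl rfl)
    rw [gadgetCoef_eq] at h₁ h₂
    simp only [chi, Finset.prod_empty, mul_one, one_mul] at h₁ h₂
    rw [← Prod.mk.eta (p := c i)]
    simp only [hite, hc]
    rw [← Finset.expect_div, Finset.expect_add_distrib, Finset.expect_add_distrib,
      Finset.expect_add_distrib, ← Finset.mul_expect, ← Finset.mul_expect, ← Finset.mul_expect]
    split_ifs with hi
    · rw [hg.expect_eq_zero, ← gadgetCoef_eq]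
      simp only [chi, h₁, h₂]
      ring
    · simp only [one_mul]
      rw [expect_prod_eq (fun p : (Fin m₁ → ℤˣ) × (Fin m₂ → ℤˣ) => chi S p.1),
        expect_prod_eq (fun p : (Fin m₁ → ℤˣ) × (Fin m₂ → ℤˣ) => chi T p.2),
        expect_prod_eq (fun p : (Fin m₁ → ℤˣ) × (Fin m₂ → ℤˣ) => chi S p.1 * chi T p.2)]
      simp only [← Finset.mul_expect, expect_chi hT, Fintype.expect_const, expect_chi hS]
      simp
  simp only [key]
  rw [mul_left_comm]
  congr 1
  rw [Finset.prod_ite_mem, Finset.prod_ite_mem, Finset.univ_inter, Finset.prod_mul_distrib,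
    Finset.prod_const, Finset.prod_ite_mem, Finset.univ_inter, Finset.prod_mul_distrib]

lemma sum_chi_mul_chi {m : ℕ} (x x' : Fin m → ℤˣ) :
    ∑ S, chi S x * chi S x' = if x = x' then (2 : ℝ) ^ m else 0 := by
  have h : ∑ S, chi S x * chi S x' = ∏ i, (1 + pm (x i) * pm (x' i)) := by
    rw [Finset.prod_one_add, Finset.powerset_univ]
    simp [chi, Finset.prod_mul_distrib]
  rw [h]
  split_ifs with hx
  · subst hx
    simp only [pm_sq]
    norm_num
  · obtain ⟨i, hi⟩ := Function.ne_iff.1 hx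
    refine Finset.prod_eq_zero (mem_univ i) ?_
    have := ite_eq_pm (x i) (x' i) 2
    rw [if_neg hi] at this
    linarith

/-- Parseval's identity for the Fourier expansion of a gadget. -/
lemma sum_gadgetCoef_sq (g : (Fin m₁ → ℤˣ) → (Fin m₂ → ℤˣ) → ℤˣ) :
    ∑ S, ∑ T, gadgetCoef g S T ^ 2 = 1 := by
  have h : ∀ S T, gadgetCoef g S T ^ 2 = 𝔼 p : (Fin m₁ → ℤˣ) × (Fin m₂ → ℤˣ),
      𝔼 q : (Fin m₁ → ℤˣ) × (Fin m₂ → ℤˣ), pm (g p.1 p.2) * pm (g q.1 q.2)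
        * ((chi S p.1 * chi S q.1) * (chi T p.2 * chi T q.2)) := by
    intro S T
    rw [sq, gadgetCoef_eq, Finset.expect_mul_expect]
    refine Finset.expect_congr rfl fun p _ => Finset.expect_congr rfl fun q _ => ?_
    ring
  simp only [h]
  simp only [← Finset.expect_sum_comm, ← Finset.mul_sum, ← Finset.sum_mul, sum_chi_mul_chi]
  have : ∀ p q : (Fin m₁ → ℤˣ) × (Fin m₂ → ℤˣ), pm (g p.1 p.2) * pm (g q.1 q.2)
      * ((if p.1 = q.1 then (2 : ℝ) ^ m₁ else 0) * (if p.2 = q.2 then (2 : ℝ) ^ m₂ else 0))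
      = if p = q then (2 : ℝ) ^ m₁ * 2 ^ m₂ else 0 := by
    rintro ⟨a, b⟩ ⟨a', b'⟩
    by_cases h₁ : a = a' <;> by_cases h₂ : b = b' <;> simp [h₁, h₂, pm_sq]
  simp only [this, Fintype.expect_eq_sum_div_card, Finset.sum_ite_eq, mem_univ, if_true,
    Finset.sum_const, Finset.card_univ, Fintype.card_prod, Fintype.card_fun, Fintype.card_fin]
  have hc : Fintype.card ℤˣ = 2 := by decide
  rw [hc]
  push_cast
  simp only [nsmul_eq_mul, Nat.cast_mul, Nat.cast_pow, Nat.cast_ofNat]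
  field_simp

lemma abs_gadgetCoef_le (g : (Fin m₁ → ℤˣ) → (Fin m₂ → ℤˣ) → ℤˣ) (S : Finset (Fin m₁))
    (T : Finset (Fin m₂)) : |gadgetCoef g S T| ≤ 1 := by
  rw [gadgetCoef_eq]
  refine (Finset.abs_expect_le _ _).trans (Finset.expect_le univ_nonempty fun p _ => ?_)
  simp [abs_mul, abs_pm, abs_chi]

lemma le_gadgetMaxCoef (g : (Fin m₁ → ℤˣ) → (Fin m₂ → ℤˣ) → ℤˣ) (S : Finset (Fin m₁))
    (T : Finset (Fin m₂)) : |gadgetCoef g S T| ≤ gadgetMaxCoef g :=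
  Finset.le_sup' (fun P : Finset (Fin m₁) × Finset (Fin m₂) => |gadgetCoef g P.1 P.2|)
    (mem_univ (S, T))

lemma exists_gadgetMaxCoef_eq (g : (Fin m₁ → ℤˣ) → (Fin m₂ → ℤˣ) → ℤˣ) :
    ∃ S T, gadgetMaxCoef g = |gadgetCoef g S T| := by
  obtain ⟨P, -, hP⟩ := Finset.exists_mem_eq_sup' (univ_nonempty)
    (fun P : Finset (Fin m₁) × Finset (Fin m₂) => |gadgetCoef g P.1 P.2|)
  exact ⟨P.1, P.2, hP⟩

lemma gadgetMaxCoef_nonneg (g : (Fin m₁ → ℤˣ) → (Fin m₂ → ℤˣ) → ℤˣ) : 0 ≤ gadgetMaxCoef g :=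
  (abs_nonneg _).trans (le_gadgetMaxCoef g ∅ ∅)

lemma gadgetMaxCoef_le_one (g : (Fin m₁ → ℤˣ) → (Fin m₂ → ℤˣ) → ℤˣ) : gadgetMaxCoef g ≤ 1 := by
  obtain ⟨S, T, h⟩ := exists_gadgetMaxCoef_eq g
  exact h ▸ abs_gadgetCoef_le g S T

/-- The squares of the `2 ^ (m₁ + m₂)` coefficients sum to `1`, so the largest is at least the
average. -/
lemma one_le_pow_mul_gadgetMaxCoef_sq (g : (Fin m₁ → ℤˣ) → (Fin m₂ → ℤˣ) → ℤˣ) :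
    1 ≤ (2 : ℝ) ^ (m₁ + m₂) * gadgetMaxCoef g ^ 2 := by
  rw [← sum_gadgetCoef_sq g]
  calc ∑ S, ∑ T, gadgetCoef g S T ^ 2
      ≤ ∑ _S : Finset (Fin m₁), ∑ _T : Finset (Fin m₂), gadgetMaxCoef g ^ 2 := by
        refine Finset.sum_le_sum fun S _ => Finset.sum_le_sum fun T _ => ?_
        rw [← sq_abs]
        exact pow_le_pow_left₀ (abs_nonneg _) (le_gadgetMaxCoef g S T) 2
    _ = _ := by
        simp [Fintype.card_finset, pow_add]
        ring

lemma gadgetMaxCoef_pos (g : (Fin m₁ → ℤˣ) → (Fin m₂ → ℤˣ) → ℤˣ) : 0 < gadgetMaxCoef g := by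
  refine (gadgetMaxCoef_nonneg g).lt_of_ne fun h => ?_
  have := one_le_pow_mul_gadgetMaxCoef_sq g
  rw [← h] at this
  norm_num at this

lemma inv_gadgetMaxCoef_pow_le (g : (Fin m₁ → ℤˣ) → (Fin m₂ → ℤˣ) → ℤˣ) (k : ℕ) :
    (gadgetMaxCoef g ^ k)⁻¹ ≤ (2 : ℝ) ^ (((m₁ : ℝ) + (m₂ : ℝ)) * (k : ℝ) / 2) := by
  have h := gadgetMaxCoef_pos g
  have h₁ := one_le_pow_mul_gadgetMaxCoef_sq g
  have e : (2 : ℝ) ^ (((m₁ : ℝ) + (m₂ : ℝ)) * (k : ℝ) / 2)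
      = ((2 : ℝ) ^ (((m₁ : ℝ) + (m₂ : ℝ)) / 2)) ^ k := by
    rw [← Real.rpow_natCast, ← Real.rpow_mul (by norm_num)]
    ring_nf
  have e₂ : ((2 : ℝ) ^ (((m₁ : ℝ) + (m₂ : ℝ)) / 2)) ^ 2 = 2 ^ (m₁ + m₂) := by
    rw [← Real.rpow_natCast, ← Real.rpow_mul (by norm_num), ← Real.rpow_natCast]
    push_cast
    ring_nf
  rw [e, ← inv_pow]
  refine pow_le_pow_left₀ (by positivity) ?_ k
  refine le_of_pow_le_pow_left₀ two_ne_zero (by positivity) ?_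
  rw [e₂, inv_pow, inv_le_iff_one_le_mul₀ (by positivity)]
  exact h₁

end Gadgets

/-! ### Input substitution and protocols with few bits -/

namespace Protocol

variable {X Y X' Y' : Type}

/-- The protocol in which both players first apply a map to their inputs. -/
def comap (φ : X' → X) (ψ : Y' → Y) : Protocol X Y → Protocol X' Y'
  | leaf b => leaf b
  | alice bit p q => alice (fun x => bit (φ x)) (p.comap φ ψ) (q.comap φ ψ)
  | bob bit p q => bob (fun y => bit (ψ y)) (p.comap φ ψ) (q.comap φ ψ)

lemma run_comap (φ : X' → X) (ψ : Y' → Y) (P : Protocol X Y) (x : X') (y : Y') :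
    (P.comap φ ψ).run x y = P.run (φ x) (ψ y) := by
  induction P with
  | leaf => rfl
  | alice bit p q hp hq => simp only [comap, run, hp, hq]
  | bob bit p q hp hq => simp only [comap, run, hp, hq]

lemma cost_comap (φ : X' → X) (ψ : Y' → Y) (P : Protocol X Y) : (P.comap φ ψ).cost = P.cost := by
  induction P with
  | leaf => rfl
  | alice bit p q hp hq => simp only [comap, cost, hp, hq]
  | bob bit p q hp hq => simp only [comap, cost, hp, hq]

/-- The protocol that outputs the product of a sign known to Alice and a sign known to Bob. -/
def mulSigns (a : X → ℤˣ) (b : Y → ℤˣ) : Protocol X Y :=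
  alice (fun x => a x = 1)
    (bob (fun y => b y = 1) (leaf 1) (leaf (-1))) (bob (fun y => b y = 1) (leaf (-1)) (leaf 1))

lemma run_mulSigns (a : X → ℤˣ) (b : Y → ℤˣ) (x : X) (y : Y) :
    (mulSigns a b).run x y = a x * b y := by
  rcases Int.units_eq_one_or (a x) with ha | ha <;> rcases Int.units_eq_one_or (b y) with hb | hb <;>
    simp [mulSigns, run, ha, hb]

lemma cost_mulSigns (a : X → ℤˣ) (b : Y → ℤˣ) : (mulSigns a b).cost = 2 := rfl

lemma cost_eq_zero {P : Protocol X Y} (h : P.cost = 0) : ∃ b, P = leaf b := by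
  cases P with
  | leaf b => exact ⟨b, rfl⟩
  | alice => simp [cost] at h
  | bob => simp [cost] at h

/-- With one bit of communication, the output depends on one of the two inputs only. -/
lemma run_of_cost_le_one {P : Protocol X Y} (h : P.cost ≤ 1) :
    (∃ a : X → ℤˣ, ∀ x y, P.run x y = a x) ∨ ∃ b : Y → ℤˣ, ∀ x y, P.run x y = b y := by
  cases P with
  | leaf b => exact Or.inl ⟨fun _ => b, fun _ _ => rfl⟩
  | alice bit p q =>
    simp only [cost] at h
    obtain ⟨b, rfl⟩ := cost_eq_zero (P := p) (by omega)
    obtain ⟨b', rfl⟩ := cost_eq_zero (P := q) (by omega)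
    exact Or.inl ⟨fun x => if bit x then b' else b, fun _ _ => rfl⟩
  | bob bit p q =>
    simp only [cost] at h
    obtain ⟨b, rfl⟩ := cost_eq_zero (P := p) (by omega)
    obtain ⟨b', rfl⟩ := cost_eq_zero (P := q) (by omega)
    exact Or.inr ⟨fun y => if bit y then b' else b, fun _ _ => rfl⟩

/-- The output ignores one player's input, and flipping a coordinate of that input in `J` negates
the character. -/
lemma fourierCoef_xorFiber_eq_zero {n : ℕ} {P : Protocol (Fin n → ℤˣ) (Fin n → ℤˣ)}
    (h : P.cost ≤ 1) {J : Finset (Fin n)} (hJ : J.Nonempty) :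
    fourierCoef (xorFiber fun x y => pm (P.run x y)) J = 0 := by
  rw [fourierCoef_xorFiber]
  obtain ⟨i, hi⟩ := hJ
  rcases run_of_cost_le_one h with ⟨a, ha⟩ | ⟨b, hb⟩
  · refine expect_eq_zero_of_involutive (σ := fun p => (p.1, flipAt i p.2))
      (fun p => by simp [flipAt_flipAt]) fun p => ?_
    simp only [ha, chi_flipAt_of_mem hi]
    ring
  · refine expect_eq_zero_of_involutive (σ := fun p => (flipAt i p.1, p.2))
      (fun p => by simp [flipAt_flipAt]) fun p => ?_
    simp only [hb, chi_flipAt_of_mem hi]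
    ring

end Protocol

namespace RandProtocol

variable {X Y X' Y' : Type}

lemma abs_value_le (C : RandProtocol X Y) (x : X) (y : Y) : |C.value x y| ≤ 1 :=
  PMF.abs_tsum_toReal_mul_le C fun _ => (abs_pm _).le

/-- The randomized protocol in which both players first apply a map to their inputs. -/
def comap (φ : X' → X) (ψ : Y' → Y) (C : RandProtocol X Y) : RandProtocol X' Y' :=
  PMF.map (Protocol.comap φ ψ) C

lemma value_comap (φ : X' → X) (ψ : Y' → Y) (C : RandProtocol X Y) (x : X') (y : Y') :
    (C.comap φ ψ).value x y = C.value (φ x) (ψ y) := by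
  rw [value, comap, PMF.tsum_map_toReal_mul C (Protocol.comap φ ψ) (h := fun P => pm (P.run x y))
    fun P => (abs_pm _).le]
  simp only [Protocol.run_comap]
  rfl

lemma CostLE.comap {C : RandProtocol X Y} {d : ℕ} (h : C.CostLE d) (φ : X' → X) (ψ : Y' → Y) :
    (C.comap φ ψ).CostLE d := by
  intro P hP
  rw [RandProtocol.comap, PMF.support_map] at hP
  obtain ⟨P', hP', rfl⟩ := hP
  rw [Protocol.cost_comap]
  exact h P' hP'

lemma value_pure (P : Protocol X Y) (x : X) (y : Y) :
    value (PMF.pure P) x y = pm (P.run x y) := by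
  rw [value, tsum_eq_single P]
  · simp
  · intro P' h
    simp [PMF.pure_apply, h]

lemma costLE_pure {P : Protocol X Y} {d : ℕ} (h : P.cost ≤ d) :
    CostLE (PMF.pure P) d := by
  intro P' hP'
  rw [PMF.support_pure, Set.mem_singleton_iff] at hP'
  exact hP' ▸ h

lemma fourierCoef_xorFiber_eq_zero {n d : ℕ} {C : RandProtocol (Fin n → ℤˣ) (Fin n → ℤˣ)}
    (h : C.CostLE d) (hd : d ≤ 1) {J : Finset (Fin n)} (hJ : J.Nonempty) :
    fourierCoef (xorFiber C.value) J = 0 := by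
  have e : fourierCoef (xorFiber C.value) J
      = ∑' P, (C P).toReal * fourierCoef (xorFiber fun x y => pm (P.run x y)) J := by
    simp only [fourierCoef_xorFiber, Fintype.expect_eq_sum_div_card, div_eq_inv_mul]
    simp only [Finset.mul_sum (univ : Finset ((Fin n → ℤˣ) × (Fin n → ℤˣ)))]
    have := PMF.sum_mul_tsum C univ
      (fun p : (Fin n → ℤˣ) × (Fin n → ℤˣ) =>
        ((Fintype.card ((Fin n → ℤˣ) × (Fin n → ℤˣ)) : ℝ))⁻¹ * (chi J p.1 * chi J p.2))
      (h := fun P p => pm (P.run p.1 p.2)) (B := 1) (fun P p => (abs_pm _).le)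
    refine (Eq.trans ?_ this).trans ?_
    · exact Finset.sum_congr rfl fun p _ => by rw [value]; ring
    · refine tsum_congr fun P => ?_
      rw [Finset.mul_sum]
      exact Finset.sum_congr rfl fun p _ => by ring
  rw [e, ← tsum_zero (α := ℝ) (β := Protocol (Fin n → ℤˣ) (Fin n → ℤˣ))]
  refine tsum_congr fun P => ?_
  by_cases hP : C P = 0
  · simp [hP]
  · rw [Protocol.fourierCoef_xorFiber_eq_zero ((h P ((C.mem_support_iff P).2 hP)).trans hd) hJ,
      mul_zero]

end RandProtocol

/-! ### Fourier growth of bounded functions and of randomized trees -/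

lemma fourierGrowth_nonneg (k : ℕ) (f : (Fin n → ℤˣ) → ℝ) : 0 ≤ fourierGrowth k f :=
  Finset.sum_nonneg fun _ _ => abs_nonneg _

lemma exists_sign_mul_eq_abs (a : ℝ) : ∃ w : ℝ, |w| = 1 ∧ w * a = |a| := by
  rcases abs_choice a with h | h
  · exact ⟨1, by simp, by rw [h, one_mul]⟩
  · exact ⟨-1, by simp, by rw [h, neg_one_mul]⟩

lemma exists_signs_fourierGrowth (k : ℕ) (f : (Fin n → ℤˣ) → ℝ) :
    ∃ w : Finset (Fin n) → ℝ, (∀ S, |w S| = 1) ∧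
      fourierGrowth k f = ∑ S ∈ powersetCard k univ, w S * fourierCoef f S := by
  choose w hw using fun S => exists_sign_mul_eq_abs (fourierCoef f S)
  exact ⟨w, fun S => (hw S).1, Finset.sum_congr rfl fun S _ => (hw S).2.symm⟩

lemma fourierCoef_sub (f h : (Fin n → ℤˣ) → ℝ) (S : Finset (Fin n)) :
    fourierCoef (fun z => f z - h z) S = fourierCoef f S - fourierCoef h S := by
  simp only [fourierCoef, sub_mul, Finset.expect_sub_distrib]

lemma fourierGrowth_le_add (k : ℕ) (f h : (Fin n → ℤˣ) → ℝ) :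
    fourierGrowth k f ≤ fourierGrowth k h + fourierGrowth k fun z => h z - f z := by
  rw [fourierGrowth, fourierGrowth, fourierGrowth, ← Finset.sum_add_distrib]
  refine Finset.sum_le_sum fun S _ => ?_
  rw [fourierCoef_sub]
  have := abs_sub_abs_le_abs_sub (fourierCoef f S) (fourierCoef h S)
  rw [abs_sub_comm] at this
  linarith

lemma abs_fourierCoef_le {f : (Fin n → ℤˣ) → ℝ} {b : ℝ} (hf : ∀ z, |f z| ≤ b)
    (S : Finset (Fin n)) : |fourierCoef f S| ≤ b := by
  refine (Finset.abs_expect_le _ _).trans (Finset.expect_le univ_nonempty fun z _ => ?_)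
  rw [abs_mul, abs_chi, mul_one]
  exact hf z

lemma fourierGrowth_le_choose_mul {f : (Fin n → ℤˣ) → ℝ} {b : ℝ} (hf : ∀ z, |f z| ≤ b) (k : ℕ) :
    fourierGrowth k f ≤ n.choose k * b := by
  refine (Finset.sum_le_sum fun S _ => abs_fourierCoef_le hf S).trans_eq ?_
  simp

/-- The first level of a bounded function. -/
lemma fourierGrowth_one_le {f : (Fin n → ℤˣ) → ℝ} {b : ℝ} (hf : ∀ z, |f z| ≤ b) :
    fourierGrowth 1 f ≤ b * walkAbs n 0 := by
  obtain ⟨w, hw, e⟩ := exists_signs_fourierGrowth 1 f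
  have hb : 0 ≤ b := (abs_nonneg _).trans (hf 1)
  calc fourierGrowth 1 f = 𝔼 z, f z * ∑ i, w {i} * pm (z i) := by
        rw [e, Finset.powersetCard_one, Finset.sum_map]
        simp only [fourierCoef, Finset.mul_expect, Finset.mul_sum]
        rw [← Finset.expect_sum_comm]
        refine Finset.expect_congr rfl fun z _ => Finset.sum_congr rfl fun i _ => ?_
        simp [chi]
        ring
    _ ≤ 𝔼 z : Fin n → ℤˣ, b * |∑ i, w {i} * pm (z i)| :=
        Finset.expect_le_expect fun z _ => (le_abs_self _).trans (by
          rw [abs_mul]; exact mul_le_mul_of_nonneg_right (hf z) (abs_nonneg _))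
    _ ≤ b * walkAbs n 0 := by
        rw [← Finset.mul_expect]
        exact mul_le_mul_of_nonneg_left (expect_abs_sum_le_walkAbs (fun i => w {i}) fun i => hw _) hb

namespace RandDecTree

lemma sum_mul_fourierCoef_value (T : RandDecTree n) (s : Finset (Finset (Fin n)))
    (w : Finset (Fin n) → ℝ) :
    ∑ S ∈ s, w S * fourierCoef T.value S
      = ∑' t, (T t).toReal * ∑ S ∈ s, w S * fourierCoef (fun z => pm (t.run z)) S := by
  have h₁ : ∀ S, fourierCoef T.value S
      = ∑' t, (T t).toReal * fourierCoef (fun z => pm (t.run z)) S := by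
    intro S
    have := PMF.sum_mul_tsum T univ
      (fun z : Fin n → ℤˣ => ((Fintype.card (Fin n → ℤˣ) : ℝ))⁻¹ * chi S z)
      (h := fun t z => pm (t.run z)) (B := 1) (fun t z => (abs_pm _).le)
    simp only [fourierCoef, Fintype.expect_eq_sum_div_card, div_eq_inv_mul]
    simp only [Finset.mul_sum (univ : Finset (Fin n → ℤˣ))]
    refine (Eq.trans ?_ this).trans ?_
    · exact Finset.sum_congr rfl fun z _ => by rw [value]; ring
    · refine tsum_congr fun t => ?_
      rw [Finset.mul_sum]
      exact Finset.sum_congr rfl fun z _ => by ring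
  simp only [h₁]
  exact PMF.sum_mul_tsum T s w (B := 1) fun t S => abs_fourierCoef_le (fun z => (abs_pm _).le) S

/-- A bound for signed sums of coefficients that holds for all trees of depth at most `D` holds
for mixtures of such trees. -/
lemma fourierGrowth_value_le {T : RandDecTree n} {D k : ℕ} (hT : T.DepthLE D) {b : ℝ}
    (hb : ∀ t : DecTree n, t.depth ≤ D → ∀ w : Finset (Fin n) → ℝ, (∀ S, |w S| = 1) →
      𝔼 z, |derivSum w k ∅ (t.queried z D) z| ≤ b) :
    fourierGrowth k T.value ≤ b := by
  obtain ⟨w, hw, e⟩ := exists_signs_fourierGrowth k T.value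
  rw [e, sum_mul_fourierCoef_value]
  -- The crude bound `B` serves only to make the series summable.
  refine PMF.tsum_toReal_mul_le T (B := ∑ _S ∈ powersetCard k (univ : Finset (Fin n)), 1)
    (fun t => ?_) fun t ht => ?_
  · refine (Finset.abs_sum_le_sum_abs _ _).trans (Finset.sum_le_sum fun S _ => ?_)
    rw [abs_mul, hw, one_mul]
    exact abs_fourierCoef_le (fun z => (abs_pm _).le) S
  · exact (DecTree.sum_mul_fourierCoef_le (hT t ht) w k).trans (hb t (hT t ht) w hw)

lemma fourierCoef_value_eq_zero {T : RandDecTree n} {D : ℕ} (hT : T.DepthLE D)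
    {S : Finset (Fin n)} (hS : D < #S) : fourierCoef T.value S = 0 := by
  have h := sum_mul_fourierCoef_value T {S} fun _ => 1
  simp only [Finset.sum_singleton, one_mul] at h
  rw [h, ← tsum_zero (α := ℝ) (β := DecTree n)]
  refine tsum_congr fun t => ?_
  by_cases ht : T t = 0
  · simp [ht]
  · rw [DecTree.fourierCoef_run_eq_zero (hT t ((T.mem_support_iff t).2 ht)) hS, mul_zero]

lemma fourierGrowth_one_value_le {T : RandDecTree n} {D : ℕ} (hT : T.DepthLE D) :
    fourierGrowth 1 T.value ≤ walkAbs D 0 :=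
  fourierGrowth_value_le hT fun t _ w hw => by
    simpa [walkAbs] using t.expect_walkAbs_derivSum_le hw D 0

/-- The Fourier growth of randomized decision trees. -/
lemma fourierGrowth_succ_value_le {T : RandDecTree n} {D : ℕ} (hT : T.DepthLE D) (r : ℕ)
    {m : ℕ} (hm : m ≠ 0) (hn : n ≤ 2 ^ m) :
    fourierGrowth (r + 1) T.value ≤ √(2 * (8 * m : ℝ) ^ r * D.choose (r + 1)) :=
  fourierGrowth_value_le hT fun t _ _ hw => expect_abs_le_sqrt.trans
    (Real.sqrt_le_sqrt (t.expect_derivSum_sq_le (fun S => (hw S).le) hm hn r D))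

end RandDecTree

/-! ### Numerical estimates -/

/-- With `clog ≤ 2 log₂ n` and the leading `2` at most `2 ^ r`, the radicand is at most `Z`, whose
base is `2·8·2 = 32`. The error `1` is at most `√Z`, and doubling `√Z` multiplies the radicand by `4
≤ 4 ^ r`, whence `128`. Both absorptions need `r ≥ 1`. -/
lemma sqrt_bound_absorb {n D r : ℕ} (hn : 2 ≤ n) (hr : 1 ≤ r) (hD : 1 ≤ D) :
    √(2 * (8 * (Nat.clog 2 n : ℕ) : ℝ) ^ r * D.choose (r + 1)) + 1
      ≤ √((D : ℝ) ^ (r + 1) * (128 * Real.logb 2 n) ^ r) := by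
  set l := Real.logb 2 n
  have hn' : (2 : ℝ) ≤ n := by exact_mod_cast hn
  have hl : 1 ≤ l := by
    rw [Real.le_logb_iff_rpow_le (by norm_num) (by linarith)]
    simpa using hn'
  have hm : (Nat.clog 2 n : ℝ) ≤ 2 * l := by
    have h₁ : (Nat.clog 2 n : ℝ) ≤ l + 1 := by
      have h : (⌈l⌉ : ℤ) = Nat.clog 2 n := by
        have h' := Real.ceil_logb_natCast (b := 2) (r := (n : ℝ)) (by positivity)
        rwa [Int.clog_natCast] at h'
      have h2 := (Int.ceil_lt_add_one l).le
      rw [h] at h2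
      exact_mod_cast h2
    linarith
  set Z := (D : ℝ) ^ (r + 1) * (32 * l) ^ r with hZ
  have hDr : (1 : ℝ) ≤ D := by exact_mod_cast hD
  have hZ1 : 1 ≤ Z := one_le_mul_of_one_le_of_one_le (one_le_pow₀ hDr) (one_le_pow₀ (by linarith))
  have h₁ : 2 * (8 * (Nat.clog 2 n : ℕ) : ℝ) ^ r * D.choose (r + 1) ≤ Z := by
    have hc : (D.choose (r + 1) : ℝ) ≤ (D : ℝ) ^ (r + 1) := by
      exact_mod_cast Nat.choose_le_pow D (r + 1)
    have h2 : (2 : ℝ) ≤ 2 ^ r := by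
      simpa using pow_le_pow_right₀ (by norm_num : (1 : ℝ) ≤ 2) hr
    calc 2 * (8 * (Nat.clog 2 n : ℕ) : ℝ) ^ r * D.choose (r + 1)
        ≤ 2 ^ r * (8 * (2 * l)) ^ r * (D : ℝ) ^ (r + 1) := by gcongr
      _ = Z := by
        rw [hZ, ← mul_pow]
        ring_nf
  have h₂ : 4 * Z ≤ (D : ℝ) ^ (r + 1) * (128 * l) ^ r := by
    have h4 : (4 : ℝ) ≤ 4 ^ r := by
      simpa using pow_le_pow_right₀ (by norm_num : (1 : ℝ) ≤ 4) hr
    rw [hZ, show 128 * l = 4 * (32 * l) by ring, mul_pow 4 (32 * l)]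
    have : 0 ≤ (D : ℝ) ^ (r + 1) * (32 * l) ^ r := by positivity
    nlinarith
  calc √(2 * (8 * (Nat.clog 2 n : ℕ) : ℝ) ^ r * D.choose (r + 1)) + 1
      ≤ √Z + √Z := add_le_add (Real.sqrt_le_sqrt h₁) (Real.one_le_sqrt.2 hZ1)
    _ = √(4 * Z) := by
        rw [Real.sqrt_mul (by norm_num) Z, show √(4 : ℝ) = 2 by
          rw [show (4 : ℝ) = 2 ^ 2 by norm_num, Real.sqrt_sq (by norm_num)]]
        ring
    _ ≤ _ := Real.sqrt_le_sqrt h₂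

/-- The numerical core at the first level. -/
lemma le_sqrt_depth {n D : ℕ} {ρ L : ℝ} (hρ : 0 ≤ ρ) (hρ1 : ρ ≤ 1) (hD : 1 ≤ D) (hDn : D < n)
    (hpow : ρ ^ (D + 1) ≤ (n : ℝ)⁻¹) (h₁ : L ≤ ρ * walkAbs n 0)
    (h₂ : L ≤ walkAbs D 0 + (n : ℝ)⁻¹ * walkAbs n 0) : L ≤ √D := by
  have hn0 : (0 : ℝ) < n := by exact_mod_cast (by omega : 0 < n)
  have hw0 : 0 ≤ walkAbs n 0 := by
    have := walkAbs_monotone 0 (Nat.zero_le n)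
    simpa [walkAbs] using this
  have hsn : 0 < √(n : ℝ) := Real.sqrt_pos.2 hn0
  have hsn2 : √(n : ℝ) * √n = n := Real.mul_self_sqrt hn0.le
  -- powers of `ρ * a` for a bound `a` on the walk
  have hpw : ∀ a : ℝ, walkAbs n 0 ≤ a → a ^ (D + 1) ≤ n * √D ^ (D + 1) → L ≤ √D := by
    intro a ha hle
    have ha0 : 0 ≤ a := hw0.trans ha
    refine (h₁.trans (mul_le_mul_of_nonneg_left ha hρ)).trans ?_
    refine le_of_pow_le_pow_left₀ (Nat.succ_ne_zero D) (Real.sqrt_nonneg _) ?_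
    rw [mul_pow]
    calc ρ ^ (D + 1) * a ^ (D + 1) ≤ (n : ℝ)⁻¹ * (n * √D ^ (D + 1)) := by gcongr
      _ = √D ^ (D + 1) := by field_simp
  -- the error term
  have herr : 4 ≤ n → (n : ℝ)⁻¹ * walkAbs n 0 ≤ 9 / 10 / √n := by
    intro h4
    calc (n : ℝ)⁻¹ * walkAbs n 0 ≤ (n : ℝ)⁻¹ * (9 / 10 * √n) := by
          gcongr; exact walkAbs_zero_le h4
      _ = 9 / 10 / √n := by
          rw [eq_div_iff hsn.ne', mul_assoc, mul_assoc, hsn2]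
          field_simp
  -- Here `q` is a rational lower bound for `√n`, chosen in each case below so that the final
  -- comparison is decidable numerically.
  have htail : ∀ q : ℝ, 4 ≤ n → 0 < q → q ^ 2 ≤ n → walkAbs D 0 + 9 / 10 / q ≤ √D → L ≤ √D := by
    intro q h4 hq hqn hle
    refine h₂.trans (le_trans (add_le_add_right ((herr h4).trans ?_) _) hle)
    have : q ≤ √n := Real.le_sqrt_of_sq_le hqn
    gcongr
  have hmono : ∀ N : ℕ, n ≤ N → walkAbs n 0 ≤ walkAbs N 0 := fun N h => walkAbs_monotone 0 h
  -- From `D = 9` on, `0.9 √D + 0.9 / √D ≤ √D`. Smaller depths use exact values of the walk when `n`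
  -- is large enough, and otherwise the bound on `ρ`.
  rcases Nat.lt_or_ge D 9 with hD9 | hD9
  · interval_cases D
    · refine hpw _ (walkAbs_zero_le_sqrt n) ?_
      rw [Real.sq_sqrt hn0.le]
      simp
    · have e2 : √((2 : ℕ) : ℝ) ^ 2 = 2 := by rw [Real.sq_sqrt (by positivity)]; norm_num
      by_cases h : n ≤ 8
      · refine hpw _ (walkAbs_zero_le_sqrt n) ?_
        have hn8 : (n : ℝ) ≤ 8 := by exact_mod_cast h
        have : √(n : ℝ) ≤ √((2 : ℕ) : ℝ) ^ 3 := by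
          refine Real.sqrt_le_iff.2 ⟨by positivity, ?_⟩
          rw [← pow_mul, pow_mul' _ 3 2, e2]
          linarith
        calc √(n : ℝ) ^ (2 + 1) = n * √n := by rw [pow_succ, Real.sq_sqrt hn0.le]
          _ ≤ _ := by gcongr
      · refine htail 2.9 (by omega) (by norm_num) ?_ ?_
        · have : (9 : ℝ) ≤ n := by exact_mod_cast (by omega : 9 ≤ n)
          linarith
        · refine Real.le_sqrt_of_sq_le ?_
          rw [walkAbs_zero_eq, show walkNum 2 0 = 4 by decide]
          norm_num
    · have e3 : √((3 : ℕ) : ℝ) ^ (3 + 1) = 9 := by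
        rw [show 3 + 1 = 2 * 2 by norm_num, pow_mul, Real.sq_sqrt (by positivity)]; norm_num
      by_cases h13 : n ≤ 13
      · refine hpw _ (walkAbs_zero_le (by omega)) ?_
        have hn13 : (n : ℝ) ≤ 13 := by exact_mod_cast h13
        rw [e3, mul_pow, show √(n : ℝ) ^ (3 + 1) = n * n by
          rw [show 3 + 1 = 2 * 2 by norm_num, pow_mul, Real.sq_sqrt hn0.le, sq]]
        nlinarith
      -- For `n = 14, 15` the bound `0.9 √n` is too weak and the error term still too large; the
      -- exact value at time `15` suffices.
      by_cases h15 : n ≤ 15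
      · refine hpw _ (hmono 15 h15) ?_
        have hn14 : (14 : ℝ) ≤ n := by exact_mod_cast (by omega : 14 ≤ n)
        rw [e3, walkAbs_zero_eq, walkNum_fifteen]
        norm_num
        linarith
      · refine htail 4 (by omega) (by norm_num) ?_ ?_
        · have : (16 : ℝ) ≤ n := by exact_mod_cast (by omega : 16 ≤ n)
          linarith
        · refine Real.le_sqrt_of_sq_le ?_
          rw [walkAbs_zero_eq, show walkNum 3 0 = 12 by decide]
          norm_num
    · refine htail 2.2 (by omega) (by norm_num) ?_ ?_
      · have : (5 : ℝ) ≤ n := by exact_mod_cast (by omega : 5 ≤ n)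
        linarith
      · refine Real.le_sqrt_of_sq_le ?_
        rw [walkAbs_zero_eq, show walkNum 4 0 = 24 by decide]
        norm_num
    · by_cases h6 : n ≤ 6
      -- Only `n = 6` occurs, and the walk at time `6` already lies below `√5`.
      · refine h₁.trans ((mul_le_of_le_one_left hw0 hρ1).trans ((hmono 6 h6).trans ?_))
        refine Real.le_sqrt_of_sq_le ?_
        rw [walkAbs_zero_eq, show walkNum 6 0 = 120 by decide]
        norm_num
      · refine htail 2.6 (by omega) (by norm_num) ?_ ?_
        · have : (7 : ℝ) ≤ n := by exact_mod_cast (by omega : 7 ≤ n)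
          linarith
        · refine Real.le_sqrt_of_sq_le ?_
          rw [walkAbs_zero_eq, show walkNum 5 0 = 60 by decide]
          norm_num
    · refine htail 2.6 (by omega) (by norm_num) ?_ ?_
      · have : (7 : ℝ) ≤ n := by exact_mod_cast (by omega : 7 ≤ n)
        linarith
      · refine Real.le_sqrt_of_sq_le ?_
        rw [walkAbs_zero_eq, show walkNum 6 0 = 120 by decide]
        norm_num
    · refine htail 2.8 (by omega) (by norm_num) ?_ ?_
      · have : (8 : ℝ) ≤ n := by exact_mod_cast (by omega : 8 ≤ n)
        linarith
      · refine Real.le_sqrt_of_sq_le ?_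
        rw [walkAbs_zero_eq, show walkNum 7 0 = 280 by decide]
        norm_num
    · refine htail 3 (by omega) (by norm_num) ?_ ?_
      · have : (9 : ℝ) ≤ n := by exact_mod_cast (by omega : 9 ≤ n)
        linarith
      · refine Real.le_sqrt_of_sq_le ?_
        rw [walkAbs_zero_eq, show walkNum 8 0 = 560 by decide]
        norm_num
  · have hD9' : (9 : ℝ) ≤ D := by exact_mod_cast hD9
    have h3 : 3 ≤ √(D : ℝ) := Real.le_sqrt_of_sq_le (by linarith)
    have hnD : (D : ℝ) ≤ n := by exact_mod_cast hDn.le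
    refine htail (√D) (by omega) (by linarith) ?_ ?_
    · rw [Real.sq_sqrt (by positivity)]; exact hnD
    · have := walkAbs_zero_le (s := D) (by omega)
      have h' : 9 / 10 / √(D : ℝ) ≤ 1 / 10 * √D := by
        rw [div_le_iff₀ (by linarith)]
        nlinarith
      linarith

/-! ### Assembly of the theorem -/

lemma fourierGrowth_fiber_parity {m₁ m₂ : ℕ} {g : (Fin m₁ → ℤˣ) → (Fin m₂ → ℤˣ) → ℤˣ}
    (hg : GadgetBalanced g) {S : Finset (Fin m₁)} {T : Finset (Fin m₂)} (hS : S.Nonempty)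
    (hT : T.Nonempty) (F : (Fin n → ℤˣ) → (Fin n → ℤˣ) → ℝ) (k : ℕ) :
    fourierGrowth k
        (fiber g fun x y => F (fun i => parity S (x i)) fun i => parity T (y i))
      = |gadgetCoef g S T| ^ k * fourierGrowth k (xorFiber F) := by
  rw [fourierGrowth, fourierGrowth, Finset.mul_sum]
  refine Finset.sum_congr rfl fun J hJ => ?_
  rw [fourierCoef_fiber_parity hg hS hT, (Finset.mem_powersetCard.1 hJ).2, abs_mul, abs_pow]

/-- Two bits communicate one parity from each side, and their product is the character at `J` of the
entrywise product. For `#J > D` trees of depth `D` have no coefficient there, which makes this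
protocol a test of the simulation hypothesis. -/
lemma fourierCoef_xorFiber_mulSigns (J : Finset (Fin n)) :
    fourierCoef (xorFiber
      (RandProtocol.value (PMF.pure (Protocol.mulSigns (parity J) (parity J))))) J = 1 := by
  rw [fourierCoef_xorFiber]
  have : ∀ p : (Fin n → ℤˣ) × (Fin n → ℤˣ),
      RandProtocol.value (PMF.pure (Protocol.mulSigns (parity J) (parity J))) p.1 p.2
        * (chi J p.1 * chi J p.2) = 1 := by
    intro p
    rw [RandProtocol.value_pure, Protocol.run_mulSigns, pm_mul, ← pm_parity, ← pm_parity]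
    linear_combination pm (parity J p.2) * pm (parity J p.2) * pm_sq (parity J p.1)
      + pm_sq (parity J p.2)
  simp [this]

lemma fourierGrowth_xorFiber_one_le (C : RandProtocol (Fin n → ℤˣ) (Fin n → ℤˣ)) :
    fourierGrowth 1 (xorFiber C.value) ≤ walkAbs n 0 := by
  have := fourierGrowth_one_le (f := xorFiber C.value) (b := 1)
    (abs_fiber_le _ zero_le_one fun x y => C.abs_value_le x y)
  rwa [one_mul] at this

end

theorem theorem8p1 :
    ∃ c : ℝ, 0 < c ∧
      ∀ (n k d D m₁ m₂ : ℕ), 1 ≤ n → 1 ≤ k → 1 ≤ D →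
      ∀ g : (Fin m₁ → ℤˣ) → (Fin m₂ → ℤˣ) → ℤˣ, GadgetBalanced g →
      (∀ C : RandProtocol (Fin n → Fin m₁ → ℤˣ) (Fin n → Fin m₂ → ℤˣ), C.CostLE d →
        ∃ T : RandDecTree n, T.DepthLE D ∧
          ∀ z : Fin n → ℤˣ, |T.value z - fiber g C.value z| ≤ ((n : ℝ) ^ k)⁻¹) →
      ∀ C' : RandProtocol (Fin n → ℤˣ) (Fin n → ℤˣ), C'.CostLE d →
        fourierGrowth k (xorFiber C'.value)
            ≤ (gadgetMaxCoef g ^ k)⁻¹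
                * √((D : ℝ) ^ k * (c * Real.logb 2 (n : ℝ)) ^ (k - 1)) ∧
        (gadgetMaxCoef g ^ k)⁻¹
              * √((D : ℝ) ^ k * (c * Real.logb 2 (n : ℝ)) ^ (k - 1))
            ≤ (2 : ℝ) ^ (((m₁ : ℝ) + (m₂ : ℝ)) * (k : ℝ) / 2)
                * √((D : ℝ) ^ k * (c * Real.logb 2 (n : ℝ)) ^ (k - 1)) := by
  refine ⟨128, by norm_num, ?_⟩
  intro n k d D m₁ m₂ hn hk hD g hg hsim C' hC'
  refine ⟨?_, mul_le_mul_of_nonneg_right (inv_gadgetMaxCoef_pow_le g k) (Real.sqrt_nonneg _)⟩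
  have hρ := gadgetMaxCoef_pos g
  have hρ1 := gadgetMaxCoef_le_one g
  obtain ⟨S, T, hST⟩ := exists_gadgetMaxCoef_eq g
  have hne : gadgetCoef g S T ≠ 0 := abs_pos.1 (hST ▸ hρ)
  have hS : S.Nonempty := Finset.nonempty_iff_ne_empty.2 fun h => hne (hg S T (Or.inl h))
  have hT : T.Nonempty := Finset.nonempty_iff_ne_empty.2 fun h => hne (hg S T (Or.inr h))
  rw [inv_mul_eq_div, le_div_iff₀' (pow_pos hρ k)]
  have hlift : ∀ C : RandProtocol (Fin n → ℤˣ) (Fin n → ℤˣ), C.CostLE d →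
      ∃ t : RandDecTree n, t.DepthLE D ∧ ∀ z, |t.value z
        - fiber g (fun x y => C.value (fun i => parity S (x i)) fun i => parity T (y i)) z|
          ≤ ((n : ℝ) ^ k)⁻¹ := by
    intro C hC
    obtain ⟨t, ht, h⟩ := hsim (C.comap (fun x i => parity S (x i)) fun y i => parity T (y i))
      (hC.comap _ _)
    refine ⟨t, ht, fun z => ?_⟩
    have e : (C.comap (fun (x : Fin n → Fin m₁ → ℤˣ) i => parity S (x i))
        fun (y : Fin n → Fin m₂ → ℤˣ) i => parity T (y i)).value
        = fun x y => C.value (fun i => parity S (x i)) fun i => parity T (y i) := by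
      funext x y
      rw [RandProtocol.value_comap]
    rw [← e]
    exact h z
  have hgrowth := fourierGrowth_fiber_parity hg hS hT C'.value k
  rw [← hST] at hgrowth
  obtain ⟨t, ht, htz⟩ := hlift C' hC'
  have hsplit := fourierGrowth_le_add k
    (fiber g fun x y => C'.value (fun i => parity S (x i)) fun i => parity T (y i)) t.value
  rw [hgrowth] at hsplit
  obtain ⟨r, rfl⟩ : ∃ r, k = r + 1 := ⟨k - 1, by omega⟩
  rcases Nat.eq_zero_or_pos r with rfl | hr
  · simp only [zero_add, pow_one, Nat.sub_self, pow_zero, mul_one] at htz hsplit hlift ⊢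
    have hnn := fourierGrowth_nonneg 1 (xorFiber C'.value)
    rcases Nat.lt_or_ge D n with hDn | hDn
    · rcases Nat.lt_or_ge 1 d with hd | hd
      -- Simulating the character at a set of size `D + 1` leaves an error of at least `ρ ^ (D +
      -- 1)`, which is therefore at most `1 / n`.
      · obtain ⟨J, hJ⟩ := Finset.exists_subset_card_eq
          (s := (univ : Finset (Fin n))) (n := D + 1) (by simpa using hDn)
        obtain ⟨u, hu, huz⟩ := hlift (PMF.pure (Protocol.mulSigns (parity J) (parity J)))
          (RandProtocol.costLE_pure ((Protocol.cost_mulSigns _ _).trans_le hd))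
        have h := abs_fourierCoef_le huz J
        rw [fourierCoef_sub, fourierCoef_fiber_parity hg hS hT, fourierCoef_xorFiber_mulSigns,
          RandDecTree.fourierCoef_value_eq_zero hu (by omega), mul_one, zero_sub, abs_neg, abs_pow,
          ← hST, hJ.2] at h
        refine le_sqrt_depth hρ.le hρ1 hD hDn h
          (mul_le_mul_of_nonneg_left (fourierGrowth_xorFiber_one_le C') hρ.le) ?_
        exact hsplit.trans (add_le_add (RandDecTree.fourierGrowth_one_value_le ht)
          (fourierGrowth_one_le htz))
      · have h0 : fourierGrowth 1 (xorFiber C'.value) = 0 := by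
          refine Finset.sum_eq_zero fun J hJ => ?_
          rw [RandProtocol.fourierCoef_xorFiber_eq_zero hC' hd, abs_zero]
          rw [← Finset.card_pos, (Finset.mem_powersetCard.1 hJ).2]
          exact one_pos
        rw [h0, mul_zero]
        exact Real.sqrt_nonneg _
    · calc gadgetMaxCoef g * fourierGrowth 1 (xorFiber C'.value)
          ≤ walkAbs n 0 :=
            (mul_le_of_le_one_left hnn hρ1).trans (fourierGrowth_xorFiber_one_le C')
        _ ≤ √n := walkAbs_zero_le_sqrt n
        _ ≤ √D := Real.sqrt_le_sqrt (by exact_mod_cast hDn)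
  · rw [Nat.add_sub_cancel]
    rcases hn.eq_or_lt with rfl | hn2
    -- For `n = 1` the logarithm, hence the right side, is `0`, but there are no sets of size at
    -- least `2`.
    · have h0 : fourierGrowth (r + 1) (xorFiber C'.value) = 0 := by
        rw [fourierGrowth, Finset.powersetCard_eq_empty.2, Finset.sum_empty]
        simp only [Finset.card_univ, Fintype.card_fin]
        omega
      rw [h0, mul_zero]
      exact Real.sqrt_nonneg _
    · have hn0 : (0 : ℝ) < n := by exact_mod_cast hn
      have hm : Nat.clog 2 n ≠ 0 := (Nat.clog_pos one_lt_two hn2).ne'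
      have herr : (n.choose (r + 1) : ℝ) * ((n : ℝ) ^ (r + 1))⁻¹ ≤ 1 := by
        rw [← div_eq_mul_inv, div_le_one (by positivity)]
        exact_mod_cast Nat.choose_le_pow n (r + 1)
      exact hsplit.trans ((add_le_add
        (RandDecTree.fourierGrowth_succ_value_le ht r hm (Nat.le_pow_clog one_lt_two n))
        ((fourierGrowth_le_choose_mul htz (r + 1)).trans herr)).trans
          (sqrt_bound_absorb hn2 hr hD))
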